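/- Formulas are built from countably many propositional variables with Boolean connectives and $\Diamond$ (and $\Box=\neg\Diamond\neg$); $\Box^{\le m}\varphi=\varphi\wedge\Box\varphi\wedge\dots\wedge\Box^m\varphi$, and $\mathsf{Sub}(\Theta)$ is the set of subformulas of members of $\Theta$. A logic is a normal modal logic; $L_0+\Psi$ is the least logic containing $L_0\cup\Psi$; $\mathsf{K4}^{m+1}_1=\mathsf K+(\Diamond^{m+1}p\to\Diamond p)$. A modal algebra is a Boolean algebra with an operator $\Diamond$ preserving $0$ and $\vee$; an $L$-algebra is a modal algebra validating $L$; s.i. means subdirectly irreducible (in particular, with more than one element). A multi-conclusion rule $\Gamma/\Delta$ is a pair of finite sets of formulas; a rule system is a set of rules containing $\varphi/\varphi$; $\varphi,\varphi\to\psi/\psi$; $\varphi/\Box\varphi$; and $/\varphi$ for all $\varphi\in\mathsf K$, and closed under weakening, cut and substitution. $\mathcal S_L$ is the least rule system containing $/\varphi$ for all $\varphi\in L$, and $L$ is axiomatized over $L_0$ by a set $R$ of rules if $\mathcal S_L$ is the least rule system containing $\mathcal S_{L_0}\cup R$; a formula $\varphi$ is identified with the rule $/\varphi$. A Boolean homomorphism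 $h:A\to B$ between modal algebras is stable if $\Diamond h(a)\le h(\Diamond a)$ for all $a$. It satisfies the closed domain condition (CDC) for $D\subseteq A$ if $h(\Diamond a)=\Diamond h(a)$ for all $a\in D$, and the $m$-CDC for $D$ if $h(\Diamond^k a)=\Diamond^k h(a)$ for all $a\in D$ and $1\le k\le m$. For a modal algebra $A$ with a valuation $V$ and finite subformula-closed sets $\Theta\subseteq\Theta'$ of formulas, a definable filtration of $(A,V)$ for $\Theta$ through $\Theta'$ is a modal algebra $(A',\Diamond')$ with a valuation $V'$ such that $A'$ is the Boolean subalgebra of $A$ generated by $V[\Theta']$, $V'(p)=V(p)$ for variables $p\in\Theta'$ and $V'(p)=0$ for $p\notin\Theta'$, and the inclusion $A'\to A$ is stable and satisfies the CDC for $D=\{V(\varphi):\Diamond\varphi\in\Theta\}$. For a finite s.i. $\mathsf{K4}^{m+1}_1$-algebra $A$ and $D\subseteq A$, with pairwise distinct variables $p_a$ ($a\in A$), the $m$-stable canonical formula is $$\gamma^m_+(A,D)=\bigwedge\{\Box^{\le m}\gamma:\gamma\in\Gamma\}\to\bigvee\{\Box^{\le m}\delta:\delta\in\Delta\},$$ where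 $\Delta=\{p_a:a\in A,\ a\ne1\}$ and $$\Gamma=\{p_{a\vee b}\leftrightarrow p_a\vee p_b:a,b\in A\}\cup\{p_{\neg a}\leftrightarrow\neg p_a:a\in A\}\cup\{\Diamond p_a\to p_{\Diamond a}:a\in A\}\cup\{p_{\Diamond^k a}\to\Diamond^k p_a:a\in D,\ 1\le k\le m\}.$$ **Theorem.** Let $m\ge1$. 1. Let $A$ be a $\mathsf{K4}^{m+1}_1$-algebra, $V$ a valuation on $A$, and $\Theta$ a finite subformula-closed set of formulas. Let $\Theta'=\mathsf{Sub}(\Theta\cup\{\Diamond^m\varphi:\varphi\in\Theta\})$ and let $A'$ be the (finite) Boolean subalgebra of $A$ generated by $V[\Theta']$. For $a\in A'$ put $\Diamond_0a=\bigwedge\{b\in A':\Diamond a\le b\}$ and $\Diamond_1a=\bigvee\{\Diamond_0^{km+1}a:k\in\omega\}$. Then $(A',\Diamond_1)$ is (with a suitable valuation $V'$) a definable filtration of $(A,V)$ for $\Theta$ through $\Theta'$, it is a $\mathsf{K4}^{m+1}_1$-algebra, and the inclusion $(A',\Diamond_1)\to A$ satisfies the $m$-CDC for $D=\{V(\varphi):\Diamond\varphi\in\Theta\}$.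 2. For every formula $\varphi$ there are finitely many $m$-stable canonical formulas $\gamma^m_+(A_1,D_1),\dots,\gamma^m_+(A_n,D_n)$ (with $n\geq 0$, each $A_i$ a finite s.i. $\mathsf{K4}^{m+1}_1$-algebra and $D_i\subseteq A_i$) such that for every s.i. $\mathsf{K4}^{m+1}_1$-algebra $B$: $B\models\varphi$ if and only if $B\models\bigwedge_{i=1}^n\gamma^m_+(A_i,D_i)$. 3. Every logic $L\supseteq\mathsf{K4}^{m+1}_1$ is axiomatized over $\mathsf{K4}^{m+1}_1$ by some set $\Psi$ of $m$-stable canonical formulas; in particular $L=\mathsf{K4}^{m+1}_1+\Psi$. If $L$ is finitely axiomatizable over $\mathsf{K4}^{m+1}_1$ (by finitely many rules, for instance finitely many formulas), then $\Psi$ can be chosen finite. -/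

import Mathlib

namespace PreTransitive

/-! ## Modal formulas -/

/-- Modal formulas over the countably many propositional variables `0, 1, 2, …`, with primitive
connectives `⊥`, `¬`, `∨` and `◇`. -/
inductive Formula : Type
  | var : ℕ → Formula
  | bot : Formula
  | neg : Formula → Formula
  | or : Formula → Formula → Formula
  | dia : Formula → Formula
  deriving DecidableEq

namespace Formula

def top : Formula := neg bot

def and (φ ψ : Formula) : Formula := neg (or (neg φ) (neg ψ))

def imp (φ ψ : Formula) : Formula := or (neg φ) ψ

def iff (φ ψ : Formula) : Formula := and (imp φ ψ) (imp ψ φ)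

def box (φ : Formula) : Formula := neg (dia (neg φ))

/-- `◇^k φ`. -/
def diaPow (k : ℕ) (φ : Formula) : Formula := dia^[k] φ

/-- `□^{≤ k} φ = φ ∧ □ φ ∧ ⋯ ∧ □^k φ`. -/
def boxLe : ℕ → Formula → Formula
  | 0, φ => φ
  | k + 1, φ => and (boxLe k φ) (box^[k + 1] φ)

/-- The conjunction of a finite set of formulas (the empty one is `⊤`). -/
noncomputable def conj (Γ : Finset Formula) : Formula := Γ.toList.foldr and top

/-- The disjunction of a finite set of formulas (the empty one is `⊥`). -/
noncomputable def disj (Γ : Finset Formula) : Formula := Γ.toList.foldr or bot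

/-- Application of the substitution `σ`. -/
def subst (σ : ℕ → Formula) : Formula → Formula
  | var p => σ p
  | bot => bot
  | neg φ => neg (subst σ φ)
  | or φ ψ => or (subst σ φ) (subst σ ψ)
  | dia φ => dia (subst σ φ)

/-- The set of subformulas of a formula (including the formula itself). -/
def sub : Formula → Finset Formula
  | var p => {var p}
  | bot => {bot}
  | neg φ => insert (neg φ) (sub φ)
  | or φ ψ => insert (or φ ψ) (sub φ ∪ sub ψ)
  | dia φ => insert (dia φ) (sub φ)

/-- Propositional tautologies: true under every Boolean truth assignment, where formulas `◇ ψ` are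
treated like variables. -/
def IsTautology (φ : Formula) : Prop :=
  ∀ v : Formula → Prop, ¬ v bot → (∀ ψ, v (neg ψ) ↔ ¬ v ψ) →
    (∀ ψ χ, v (or ψ χ) ↔ v ψ ∨ v χ) → v φ

end Formula

open Formula

/-- `Sub(Θ)`. -/
def subs (Θ : Finset Formula) : Finset Formula := Θ.biUnion Formula.sub

def SubformulaClosed (Θ : Finset Formula) : Prop := ∀ φ ∈ Θ, Formula.sub φ ⊆ Θ

/-! ## Normal modal logics -/

/-- A (normal modal) logic: a set of formulas that contains all tautologies, the axiom
`□(p → q) → (□p → □q)` and the duality axiom `◇p ↔ ¬□¬p`, and that is closed under modus ponens,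
necessitation and uniform substitution. -/
structure IsLogic (L : Set Formula) : Prop where
  taut : ∀ φ, IsTautology φ → φ ∈ L
  axiomK : imp (box (imp (var 0) (var 1))) (imp (box (var 0)) (box (var 1))) ∈ L
  dual : Formula.iff (dia (var 0)) (neg (box (neg (var 0)))) ∈ L
  mp : ∀ φ ψ, φ ∈ L → imp φ ψ ∈ L → ψ ∈ L
  nec : ∀ φ, φ ∈ L → box φ ∈ L
  subst : ∀ (σ : ℕ → Formula) φ, φ ∈ L → φ.subst σ ∈ L

/-- `L₀ + Ψ`: the least logic containing `L₀ ∪ Ψ`. -/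
def addFormulas (L₀ Ψ : Set Formula) : Set Formula :=
  {φ | ∀ L, IsLogic L → L₀ ∪ Ψ ⊆ L → φ ∈ L}

/-- The least normal modal logic `K`. -/
def logicK : Set Formula := addFormulas ∅ ∅

/-- The pre-transitive logic `K4^{m+1}_1 = K + (◇^{m+1} p → ◇ p)`. -/
def logicK4 (m : ℕ) : Set Formula :=
  addFormulas logicK {imp (diaPow (m + 1) (var 0)) (dia (var 0))}

/-! ## Rules and rule systems -/

/-- A multi-conclusion rule `Γ / Δ`. -/
structure Rule where
  prem : Finset Formula
  concl : Finset Formula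

/-- The assumption-free single-conclusion rule `/ φ`. -/
def Rule.ofFormula (φ : Formula) : Rule := ⟨∅, {φ}⟩

/-- Normal modal multi-conclusion rule systems. -/
structure IsRuleSystem (S : Set Rule) : Prop where
  refl : ∀ φ, (⟨{φ}, {φ}⟩ : Rule) ∈ S
  mp : ∀ φ ψ, (⟨{φ, imp φ ψ}, {ψ}⟩ : Rule) ∈ S
  nec : ∀ φ, (⟨{φ}, {box φ}⟩ : Rule) ∈ S
  ofK : ∀ φ ∈ logicK, Rule.ofFormula φ ∈ S
  weakening : ∀ Γ Δ Γ' Δ' : Finset Formula, (⟨Γ, Δ⟩ : Rule) ∈ S →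
    (⟨Γ ∪ Γ', Δ ∪ Δ'⟩ : Rule) ∈ S
  cut : ∀ (Γ Δ : Finset Formula) φ, (⟨Γ, insert φ Δ⟩ : Rule) ∈ S →
    (⟨insert φ Γ, Δ⟩ : Rule) ∈ S → (⟨Γ, Δ⟩ : Rule) ∈ S
  subst : ∀ (σ : ℕ → Formula) (Γ Δ : Finset Formula), (⟨Γ, Δ⟩ : Rule) ∈ S →
    (⟨Γ.image (Formula.subst σ), Δ.image (Formula.subst σ)⟩ : Rule) ∈ S

/-- `S₀ + R`: the least rule system containing `S₀ ∪ R`. -/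
def addRules (S₀ R : Set Rule) : Set Rule :=
  {ρ | ∀ S, IsRuleSystem S → S₀ ∪ R ⊆ S → ρ ∈ S}

/-- `S_L`: the least rule system containing `/ φ` for all `φ ∈ L`. -/
def ruleSystemOf (L : Set Formula) : Set Rule := addRules ∅ (Rule.ofFormula '' L)

/-- The logic `L` is axiomatized over the logic `L₀` by the set `R` of rules. -/
def AxiomatizedBy (L₀ L : Set Formula) (R : Set Rule) : Prop :=
  ruleSystemOf L = addRules (ruleSystemOf L₀) R

/-! ## Modal algebras -/

class ModalAlgebra (A : Type*) extends BooleanAlgebra A where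
  dia : A → A
  dia_bot : dia ⊥ = ⊥
  dia_sup : ∀ a b : A, dia (a ⊔ b) = dia a ⊔ dia b

/-- The value of a formula under the valuation `V` of the variables. -/
def eval {A : Type*} [ModalAlgebra A] (V : ℕ → A) : Formula → A
  | .var p => V p
  | .bot => ⊥
  | .neg φ => (eval V φ)ᶜ
  | .or φ ψ => eval V φ ⊔ eval V ψ
  | .dia φ => ModalAlgebra.dia (eval V φ)

/-- `A ⊨ φ`. -/
def Validates (A : Type*) [ModalAlgebra A] (φ : Formula) : Prop :=
  ∀ V : ℕ → A, eval V φ = ⊤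

/-- `A` is an `L`-algebra: it validates every formula in `L`. -/
def IsAlgebraOf (L : Set Formula) (A : Type*) [ModalAlgebra A] : Prop :=
  ∀ φ ∈ L, Validates A φ

/-- Congruences of a modal algebra. -/
structure IsCongruence {A : Type*} [ModalAlgebra A] (r : Setoid A) : Prop where
  sup : ∀ a a' b b', r a a' → r b b' → r (a ⊔ b) (a' ⊔ b')
  compl : ∀ a a', r a a' → r aᶜ a'ᶜ
  dia : ∀ a a', r a a' → r (ModalAlgebra.dia a) (ModalAlgebra.dia a')

/-- Subdirectly irreducible modal algebras: there is a least congruence among those different from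
the identity (so one-element algebras are excluded). -/
def IsSubdirectlyIrreducible (A : Type*) [ModalAlgebra A] : Prop :=
  ∃ μ : Setoid A, IsCongruence μ ∧ μ ≠ ⊥ ∧
    ∀ r : Setoid A, IsCongruence r → r ≠ ⊥ → μ ≤ r

section Stable

variable {A B : Type*} [ModalAlgebra A] [ModalAlgebra B]

/-- Stable homomorphisms; bounded lattice homomorphisms between Boolean algebras are exactly the
Boolean homomorphisms. -/
def IsStable (h : BoundedLatticeHom A B) : Prop :=
  ∀ a, ModalAlgebra.dia (h a) ≤ h (ModalAlgebra.dia a)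

/-- The closed domain condition for `D`. -/
def SatisfiesCDC (h : BoundedLatticeHom A B) (D : Set A) : Prop :=
  ∀ a ∈ D, h (ModalAlgebra.dia a) = ModalAlgebra.dia (h a)

/-- The `m`-closed domain condition for `D`. -/
def SatisfiesMCDC (m : ℕ) (h : BoundedLatticeHom A B) (D : Set A) : Prop :=
  ∀ a ∈ D, ∀ k, 1 ≤ k → k ≤ m → h (ModalAlgebra.dia^[k] a) = ModalAlgebra.dia^[k] (h a)

/-- For `i : B → A`, the set `{V(φ) : ◇φ ∈ Θ}`, as a subset of `B`. -/
def closedDomain (V : ℕ → A) (Θ : Finset Formula) (i : BoundedLatticeHom B A) : Set B :=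
  {b | ∃ φ, dia φ ∈ Θ ∧ i b = eval V φ}

/-- `(B, V')`, regarded as a subset of `A` through the inclusion `i`, is a definable filtration of
`(A, V)` for `Θ` through `Θ'`. -/
structure IsDefinableFiltration (V : ℕ → A) (Θ Θ' : Finset Formula)
    (i : BoundedLatticeHom B A) (V' : ℕ → B) : Prop where
  closed : SubformulaClosed Θ
  closed' : SubformulaClosed Θ'
  subset : Θ ⊆ Θ'
  injective : Function.Injective i
  range : Set.range i = BooleanSubalgebra.closure (eval V '' (Θ' : Set Formula))
  val : ∀ p, var p ∈ Θ' → i (V' p) = V p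
  val_bot : ∀ p, var p ∉ Θ' → V' p = ⊥
  stable : IsStable i
  cdc : SatisfiesCDC i (closedDomain V Θ i)

end Stable

/-! ## Gabbay's filtration -/

section Gabbay

/-- Infimum of a set in a finite Boolean algebra. -/
noncomputable def finInf {B : Type*} [BooleanAlgebra B] [Finite B] (s : Set B) : B :=
  (Set.toFinite s).toFinset.inf id

/-- Supremum of a set in a finite Boolean algebra. -/
noncomputable def finSup {B : Type*} [BooleanAlgebra B] [Finite B] (s : Set B) : B :=
  (Set.toFinite s).toFinset.sup id

lemma isGLB_finInf {B : Type*} [BooleanAlgebra B] [Finite B] (s : Set B) :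
    IsGLB s (finInf s) := by
  refine ⟨fun b hb => Finset.inf_le (f := id) (by simpa using hb), fun c hc => ?_⟩
  exact Finset.le_inf fun b hb => hc (by simpa using hb)

lemma isLUB_finSup {B : Type*} [BooleanAlgebra B] [Finite B] (s : Set B) :
    IsLUB s (finSup s) := by
  refine ⟨fun b hb => Finset.le_sup (f := id) (by simpa using hb), fun c hc => ?_⟩
  exact Finset.sup_le fun b hb => hc (by simpa using hb)

lemma finite_closure {A : Type*} [BooleanAlgebra A] {s : Set A} (hs : s.Finite) :
    Finite (BooleanSubalgebra.closure s) := by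
  let t : Set A := latticeClosure (insert ⊥ (insert ⊤ s))
  have ht : t.Finite := ((hs.insert ⊤).insert ⊥).latticeClosure
  have hsub : insert ⊥ (insert ⊤ s) ⊆ t := subset_latticeClosure
  have hfin : (BooleanSubalgebra.closure t : Set A).Finite := by
    have := ht.to_subtype
    refine (Set.finite_range fun u : Finset (t × t) => u.sup fun x => x.1.1 \ x.2.1).subset ?_
    intro a ha
    obtain ⟨u, hu⟩ := (BooleanSubalgebra.mem_closure_iff_sup_sdiff
      (isSublattice_latticeClosure) (hsub (by simp)) (hsub (by simp))).1 ha
    exact ⟨u, hu.symm⟩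
  refine (hfin.subset ?_).to_subtype
  exact BooleanSubalgebra.closure_mono fun x hx => hsub (by simp [hx])

variable {A : Type*} [ModalAlgebra A]

/-- `◇₀ a = ⋀ {b ∈ S : ◇ a ≤ b}` on a finite Boolean subalgebra `S`. -/
noncomputable def gabbayDia₀ (S : BooleanSubalgebra A) [Finite S] (a : S) : S :=
  finInf {b : S | ModalAlgebra.dia (a : A) ≤ b}

/-- `◇₁ a = ⋁ {◇₀^{km+1} a : k ∈ ω}`. -/
noncomputable def gabbayDia₁ (m : ℕ) (S : BooleanSubalgebra A) [Finite S] (a : S) : S :=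
  finSup {c : S | ∃ k : ℕ, c = (gabbayDia₀ S)^[k * m + 1] a}

lemma gabbayDia₀_le_iff (S : BooleanSubalgebra A) [Finite S] (a b : S) :
    gabbayDia₀ S a ≤ b ↔ ModalAlgebra.dia (a : A) ≤ b := by
  constructor
  · intro h
    have hle : ModalAlgebra.dia (a : A) ≤ (gabbayDia₀ S a : A) := by
      have key : ∀ t : Finset S, (∀ b ∈ t, ModalAlgebra.dia (a : A) ≤ b) →
          ModalAlgebra.dia (a : A) ≤ ((t.inf id : S) : A) := by
        classical
        intro t
        induction t using Finset.induction_on with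
        | empty => intro _; simp
        | insert x t _ ih =>
          intro hx
          rw [Finset.inf_insert]
          exact le_inf (hx x (by simp)) (ih fun b hb => hx b (by simp [hb]))
      exact key _ fun b hb => by simpa using hb
    exact hle.trans h
  · exact fun h => (isGLB_finInf _).1 h

lemma gabbayDia₀_bot (S : BooleanSubalgebra A) [Finite S] : gabbayDia₀ S ⊥ = ⊥ := by
  rw [eq_bot_iff, gabbayDia₀_le_iff]
  simp [ModalAlgebra.dia_bot]

lemma gabbayDia₀_sup (S : BooleanSubalgebra A) [Finite S] (a b : S) :
    gabbayDia₀ S (a ⊔ b) = gabbayDia₀ S a ⊔ gabbayDia₀ S b := by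
  refine eq_of_forall_ge_iff fun c => ?_
  rw [sup_le_iff, gabbayDia₀_le_iff, gabbayDia₀_le_iff, gabbayDia₀_le_iff,
    BooleanSubalgebra.val_sup, ModalAlgebra.dia_sup, sup_le_iff]

lemma gabbayDia₀_iterate_bot (S : BooleanSubalgebra A) [Finite S] (n : ℕ) :
    (gabbayDia₀ S)^[n] ⊥ = ⊥ :=
  Function.iterate_fixed (gabbayDia₀_bot S) n

lemma gabbayDia₀_iterate_sup (S : BooleanSubalgebra A) [Finite S] (n : ℕ) (a b : S) :
    (gabbayDia₀ S)^[n] (a ⊔ b) = (gabbayDia₀ S)^[n] a ⊔ (gabbayDia₀ S)^[n] b := by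
  induction n with
  | zero => rfl
  | succ n ih => rw [Function.iterate_succ_apply', ih, gabbayDia₀_sup,
      Function.iterate_succ_apply', Function.iterate_succ_apply']

lemma gabbayDia₁_le_iff (m : ℕ) (S : BooleanSubalgebra A) [Finite S] (a b : S) :
    gabbayDia₁ m S a ≤ b ↔ ∀ k : ℕ, (gabbayDia₀ S)^[k * m + 1] a ≤ b := by
  rw [gabbayDia₁, isLUB_le_iff (isLUB_finSup _)]
  constructor
  · exact fun h k => h ⟨k, rfl⟩
  · rintro h _ ⟨k, rfl⟩
    exact h k

lemma gabbayDia₁_bot (m : ℕ) (S : BooleanSubalgebra A) [Finite S] : gabbayDia₁ m S ⊥ = ⊥ := by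
  rw [eq_bot_iff, gabbayDia₁_le_iff]
  intro k
  rw [gabbayDia₀_iterate_bot]

lemma gabbayDia₁_sup (m : ℕ) (S : BooleanSubalgebra A) [Finite S] (a b : S) :
    gabbayDia₁ m S (a ⊔ b) = gabbayDia₁ m S a ⊔ gabbayDia₁ m S b := by
  refine eq_of_forall_ge_iff fun c => ?_
  simp only [sup_le_iff, gabbayDia₁_le_iff, gabbayDia₀_iterate_sup, forall_and]

/-- `Θ' = Sub(Θ ∪ {◇^m φ : φ ∈ Θ})`. -/
def gabbaySet (m : ℕ) (Θ : Finset Formula) : Finset Formula :=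
  subs (Θ ∪ Θ.image (diaPow m))

/-- The Boolean subalgebra `A'` of `A` generated by `V[Θ']`. -/
def gabbaySubalgebra (m : ℕ) (V : ℕ → A) (Θ : Finset Formula) : BooleanSubalgebra A :=
  BooleanSubalgebra.closure (eval V '' (gabbaySet m Θ : Set Formula))

instance finite_gabbaySubalgebra (m : ℕ) (V : ℕ → A) (Θ : Finset Formula) :
    Finite (gabbaySubalgebra m V Θ) :=
  finite_closure ((Finset.finite_toSet _).image _)

/-- The carrier `A'` of Gabbay's filtration. -/
def GabbayAlgebra (m : ℕ) (V : ℕ → A) (Θ : Finset Formula) : Type _ :=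
  gabbaySubalgebra m V Θ

/-- Gabbay's filtration `(A', ◇₁)`. -/
noncomputable instance instModalAlgebraGabbayAlgebra (m : ℕ) (V : ℕ → A) (Θ : Finset Formula) :
    ModalAlgebra (GabbayAlgebra m V Θ) where
  __ := (BooleanSubalgebra.instBooleanAlgebraCoe (gabbaySubalgebra m V Θ) :
    BooleanAlgebra (gabbaySubalgebra m V Θ))
  dia := gabbayDia₁ m (gabbaySubalgebra m V Θ)
  dia_bot := gabbayDia₁_bot m (gabbaySubalgebra m V Θ)
  dia_sup := gabbayDia₁_sup m (gabbaySubalgebra m V Θ)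

/-- The inclusion `A' → A`. -/
def gabbayInclusion (m : ℕ) (V : ℕ → A) (Θ : Finset Formula) :
    BoundedLatticeHom (GabbayAlgebra m V Θ) A :=
  (gabbaySubalgebra m V Θ).subtype

end Gabbay

/-! ## `m`-stable canonical formulas -/

section MStable

variable {A : Type*} [ModalAlgebra A] [Fintype A]

/-- The set `Γ` associated with `A` and `D`, where `p a` is the variable `p_a`. -/
def mscPremises (m : ℕ) (D : Finset A) (p : A → ℕ) : Finset Formula :=
  ((Finset.univ : Finset (A × A)).image fun x =>
    Formula.iff (var (p (x.1 ⊔ x.2))) (Formula.or (var (p x.1)) (var (p x.2)))) ∪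
  ((Finset.univ : Finset A).image fun a =>
    Formula.iff (var (p aᶜ)) (neg (var (p a)))) ∪
  ((Finset.univ : Finset A).image fun a =>
    imp (dia (var (p a))) (var (p (ModalAlgebra.dia a)))) ∪
  ((D ×ˢ Finset.Icc 1 m).image fun x =>
    imp (var (p (ModalAlgebra.dia^[x.2] x.1))) (diaPow x.2 (var (p x.1))))

open Classical in
/-- The set `Δ = {p_a : a ∈ A, a ≠ 1}`. -/
noncomputable def mscConclusions (p : A → ℕ) : Finset Formula :=
  ((Finset.univ : Finset A).filter (· ≠ ⊤)).image fun a => var (p a)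

/-- The formula `γ_+^m(A, D) = ⋀ {□^{≤m} γ : γ ∈ Γ} → ⋁ {□^{≤m} δ : δ ∈ Δ}`, where `p a` is the
variable `p_a`. -/
noncomputable def mStableCanonicalFormula (m : ℕ) (D : Finset A) (p : A → ℕ) : Formula :=
  imp (conj ((mscPremises m D p).image (boxLe m))) (disj ((mscConclusions p).image (boxLe m)))

end MStable

/-- `φ` is an `m`-stable canonical formula: it is `γ_+^m(A, D)` for some finite subdirectly
irreducible `K4^{m+1}_1`-algebra `A`, some `D ⊆ A` and some choice of pairwise distinct variables
`p_a` (`a ∈ A`). -/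
def IsMStableCanonical (m : ℕ) (φ : Formula) : Prop :=
  ∃ (A : Type) (_ : ModalAlgebra A) (_ : Fintype A) (D : Finset A) (p : A ↪ ℕ),
    IsSubdirectlyIrreducible A ∧ IsAlgebraOf (logicK4 m) A ∧ φ = mStableCanonicalFormula m D p

end PreTransitive

open PreTransitive

namespace PreTransitive
open Formula

/-! ## Elementary facts about modal algebras -/

namespace ModalAlgebra

variable {A : Type*} [ModalAlgebra A]

/-! Gabbay's filtration. `gabbayDia₀` is the least operator on A' for which the inclusion is stable,
and it agrees with ◇ wherever ◇a already lies in A'. Composing m + 1 copies of ◇₁ joins terms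
◇₀^{km+m+1}a = ◇₀^{(k+1)m+1}a, which are again terms of ◇₁a; hence (A', ◇₁) is pre-transitive. For a
in the closed domain, ◇a, …, ◇^{m+1}a all lie in A', so ◇₀^{m+1}a ≤ ◇₀a is inherited from A, the
terms with k ≥ 1 become redundant, and ◇₁^j a = ◇₀^j a = ◇^j a for 1 ≤ j ≤ m
(`gabbayDia₁_iterate_eq`, `satisfiesMCDC_gabbayInclusion`).

Canonical formulas. In a pre-transitive algebra □^{≤m}a is open, that is, below its own box, and
open elements induce congruences. Subdirect irreducibility therefore amounts to the existence of an
opremum. Stable embeddings of finite algebras reflect oprema, so filtering a refutation of φ on an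
s.i. algebra B gives a finite s.i. algebra A and a stable embedding into B, which refutes γ_+^m(A,
D) (`exists_mem_refutationFormulas_not_validates`). Conversely, the premise of γ_+^m(A, D) takes an
open value x in any pre-transitive B, and modulo x the elements p_a copy the refutation of φ on A;
if B validates φ, this forces x below a disjunct of the conclusion
(`validates_mStableCanonicalFormula`). The size of A is bounded in terms of φ, so finitely many
formulas suffice.

Axiomatization. A formula outside L is refuted on an s.i. L-algebra, namely the Lindenbaum algebra
of a maximal theory above L omitting it (`IsLogic.mem_of_forall_isSubdirectlyIrreducible`). Hence L
is generated by the canonical formulas it contains. The passage to rules rests on the conservativity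
of S_L over L (`ofFormula_mem_ruleSystemOf_iff`), and the finite case on compactness of derivations
(`exists_finite_of_mem_addRules`). -/

lemma dia_mono : Monotone (dia : A → A) := fun a b h => by
  rw [← sup_eq_right.2 h, dia_sup]
  exact le_sup_left

/-- The dual operator `□ a = ¬ ◇ ¬ a`. -/
def box (a : A) : A := (dia aᶜ)ᶜ

/-- `□^{≤ k} a = a ∧ □ a ∧ ⋯ ∧ □^k a`. -/
def boxLe : ℕ → A → A
  | 0, a => a
  | k + 1, a => boxLe k a ⊓ box^[k + 1] a

lemma box_mono : Monotone (box : A → A) := fun _ _ h =>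
  compl_le_compl (dia_mono (compl_le_compl h))

lemma box_top : box (⊤ : A) = ⊤ := by simp [box, dia_bot]

lemma box_inf (a b : A) : box (a ⊓ b) = box a ⊓ box b := by
  simp [box, compl_inf, dia_sup]

lemma boxLe_le_self (k : ℕ) (a : A) : boxLe k a ≤ a := by
  induction k with
  | zero => exact le_rfl
  | succ k ih => exact inf_le_left.trans ih

lemma boxLe_mono (k : ℕ) : Monotone (boxLe k : A → A) := by
  induction k with
  | zero => exact monotone_id
  | succ k ih => exact fun a b h => inf_le_inf (ih h) (box_mono.iterate (k + 1) h)

lemma boxLe_top (k : ℕ) : boxLe k (⊤ : A) = ⊤ := by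
  induction k with
  | zero => rfl
  | succ k ih => rw [boxLe, ih, Function.iterate_fixed box_top, inf_top_eq]

lemma box_boxLe_inf (k : ℕ) (a : A) : a ⊓ box (boxLe k a) = boxLe (k + 1) a := by
  induction k with
  | zero => rfl
  | succ k ih =>
    rw [boxLe, box_inf, ← inf_assoc, ih, ← Function.iterate_succ_apply' box]
    rfl

lemma compl_box_iterate (k : ℕ) (a : A) : (box^[k] a)ᶜ = dia^[k] aᶜ := by
  induction k with
  | zero => rfl
  | succ k ih => rw [Function.iterate_succ_apply', Function.iterate_succ_apply', ← ih, box,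
      compl_compl]

/-- A nontrivial element below which every `□^{≤ m} a` with `a ≠ ⊤` lies. -/
def IsOpremum (m : ℕ) (c : A) : Prop := c ≠ ⊤ ∧ ∀ a : A, a ≠ ⊤ → boxLe m a ≤ c

/-- The algebraic form of `K4^{m+1}_1`. -/
def IsPreTransitive (m : ℕ) (A : Type*) [ModalAlgebra A] : Prop :=
  ∀ a : A, dia^[m + 1] a ≤ dia a

/-- Dually to the axiom, □a ≤ □^{m+1}a. As m ≥ 1, □a is one of the conjuncts, so the conjunct
□^{m+1}a comes for free. This is the source of open elements throughout. -/
lemma IsPreTransitive.boxLe_le_box {m : ℕ} (hA : IsPreTransitive m A) (hm : 1 ≤ m) (a : A) :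
    boxLe m a ≤ box (boxLe m a) := by
  have h : box a ≤ box^[m + 1] a := by
    rw [← compl_le_compl_iff_le, compl_box_iterate]
    simpa [box] using hA aᶜ
  have h1 : ∀ k, 1 ≤ k → boxLe k a ≤ box a := by
    intro k hk
    induction k, hk using Nat.le_induction with
    | base => exact inf_le_right
    | succ k _ ih => exact inf_le_left.trans ih
  have h2 : boxLe m a ≤ boxLe (m + 1) a := le_inf le_rfl ((h1 m hm).trans h)
  rw [← box_boxLe_inf] at h2
  exact h2.trans inf_le_right

lemma boxLe_eq_of_le_box {m : ℕ} {x : A} (hx : x ≤ box x) : boxLe m x = x := by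
  refine le_antisymm (boxLe_le_self m x) ?_
  have h : ∀ k, x ≤ box^[k] x := by
    intro k
    induction k with
    | zero => exact le_rfl
    | succ k ih =>
      rw [Function.iterate_succ_apply']
      exact hx.trans (box_mono ih)
  induction m with
  | zero => exact le_rfl
  | succ m ih => exact le_inf ih (h _)

/-- If `x` is open and forces `a` below `b`, then it forces `◇ a` below `◇ b`. -/
lemma le_dia_himp_dia {x a b : A} (hx : x ≤ box x) (h : x ≤ a ⇨ b) : x ≤ dia a ⇨ dia b := by
  rw [le_himp_iff] at h ⊢
  -- With x moved to the right as a complement, additivity of ◇ applies, and openness of x says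
  -- exactly that ◇¬x ≤ ¬x.
  have h1 : a ≤ b ⊔ xᶜ := by rwa [← himp_eq, le_himp_iff, inf_comm]
  have h2 : dia a ≤ dia b ⊔ xᶜ := by
    refine (dia_mono h1).trans ?_
    rw [dia_sup]
    exact sup_le_sup_left (le_compl_comm.1 hx) _
  rwa [← himp_eq, le_himp_iff, inf_comm] at h2

end ModalAlgebra

/-! ## Evaluation of formulas -/

section Eval

variable {A : Type*} [ModalAlgebra A] (V : ℕ → A)

@[simp] lemma eval_var (p : ℕ) : eval V (var p) = V p := rfl
@[simp] lemma eval_bot : eval V bot = ⊥ := rfl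
@[simp] lemma eval_neg (φ : Formula) : eval V (neg φ) = (eval V φ)ᶜ := rfl
@[simp] lemma eval_or (φ ψ : Formula) : eval V (Formula.or φ ψ) = eval V φ ⊔ eval V ψ := rfl
@[simp] lemma eval_dia (φ : Formula) : eval V (dia φ) = ModalAlgebra.dia (eval V φ) := rfl
@[simp] lemma eval_top : eval V top = ⊤ := by simp [top]
@[simp] lemma eval_and (φ ψ : Formula) : eval V (Formula.and φ ψ) = eval V φ ⊓ eval V ψ := by
  simp [Formula.and]
@[simp] lemma eval_imp (φ ψ : Formula) : eval V (imp φ ψ) = eval V φ ⇨ eval V ψ := by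
  simp [imp, himp_eq, sup_comm]
@[simp] lemma eval_iff (φ ψ : Formula) :
    eval V (Formula.iff φ ψ) = bihimp (eval V φ) (eval V ψ) := by
  simp [Formula.iff, bihimp, inf_comm]
@[simp] lemma eval_box (φ : Formula) : eval V (box φ) = ModalAlgebra.box (eval V φ) := rfl

@[simp] lemma eval_diaPow (k : ℕ) (φ : Formula) :
    eval V (diaPow k φ) = ModalAlgebra.dia^[k] (eval V φ) := by
  induction k with
  | zero => rfl
  | succ k ih => rw [diaPow, Function.iterate_succ_apply', Function.iterate_succ_apply', ← ih]; rfl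

lemma eval_box_iterate (k : ℕ) (φ : Formula) :
    eval V (box^[k] φ) = ModalAlgebra.box^[k] (eval V φ) := by
  induction k with
  | zero => rfl
  | succ k ih => rw [Function.iterate_succ_apply', Function.iterate_succ_apply', ← ih]; rfl

@[simp] lemma eval_boxLe (k : ℕ) (φ : Formula) :
    eval V (boxLe k φ) = ModalAlgebra.boxLe k (eval V φ) := by
  induction k with
  | zero => rfl
  | succ k ih => rw [boxLe, eval_and, ih, eval_box_iterate]; rfl

lemma le_eval_conj_iff {x : A} (Γ : Finset Formula) :
    x ≤ eval V (conj Γ) ↔ ∀ γ ∈ Γ, x ≤ eval V γ := by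
  have h : ∀ l : List Formula, x ≤ eval V (l.foldr Formula.and top) ↔ ∀ γ ∈ l, x ≤ eval V γ := by
    intro l
    induction l with
    | nil => simp
    | cons a l ih => simp [ih]
  simpa [conj, disj] using h Γ.toList

lemma eval_disj_le_iff {x : A} (Γ : Finset Formula) :
    eval V (disj Γ) ≤ x ↔ ∀ γ ∈ Γ, eval V γ ≤ x := by
  have h : ∀ l : List Formula, eval V (l.foldr Formula.or bot) ≤ x ↔ ∀ γ ∈ l, eval V γ ≤ x := by
    intro l
    induction l with
    | nil => simp
    | cons a l ih => simp [ih]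
  simpa [conj, disj] using h Γ.toList

lemma eval_subst (σ : ℕ → Formula) (φ : Formula) :
    eval V (φ.subst σ) = eval (fun p => eval V (σ p)) φ := by
  induction φ with
  | var p => rfl
  | bot => rfl
  | neg φ ih => simp [Formula.subst, ih]
  | or φ ψ ih1 ih2 => simp [Formula.subst, ih1, ih2]
  | dia φ ih => simp [Formula.subst, ih]

/-- A value other than ⊤ lies in a prime ideal, and "the value is outside the ideal" is a truth
assignment that falsifies the formula. -/
lemma eval_eq_top_of_isTautology {φ : Formula} (h : IsTautology φ) : eval V φ = ⊤ := by
  by_contra hne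
  obtain ⟨J, hJ, hle, hd⟩ := DistribLattice.prime_ideal_of_disjoint_filter_ideal
    (F := Order.PFilter.principal (⊤ : A)) (I := Order.Ideal.principal (eval V φ)) <| by
      rw [Set.disjoint_left]
      intro a ha ha'
      have h1 : ⊤ ≤ a := ha
      have h2 : a ≤ eval V φ := ha'
      exact hne (top_le_iff.1 (h1.trans h2))
  have htop : (⊤ : A) ∉ J := fun h' =>
    Set.disjoint_left.1 hd (show (⊤ : A) ∈ Order.PFilter.principal (⊤ : A) from le_rfl) h'
  refine h (fun ψ => eval V ψ ∉ J) ?_ ?_ ?_ (hle (show eval V φ ≤ eval V φ from le_rfl))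
  · exact not_not.2 J.bot_mem
  · intro ψ
    rw [not_not, eval_neg]
    refine ⟨fun h1 => hJ.mem_or_compl_mem.resolve_right h1, fun h1 h2 => htop ?_⟩
    rw [← sup_compl_eq_top (x := eval V ψ)]
    exact Order.Ideal.sup_mem h1 h2
  · intro ψ χ
    rw [eval_or, Order.Ideal.sup_mem_iff]
    tauto

end Eval

/-! ## Soundness -/

lemma isLogic_validates (A : Type*) [ModalAlgebra A] : IsLogic {φ | Validates A φ} where
  taut φ h V := eval_eq_top_of_isTautology V h
  axiomK V := by
    simp only [eval_imp, eval_box, himp_eq_top_iff, le_himp_iff, ← ModalAlgebra.box_inf]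
    exact ModalAlgebra.box_mono himp_inf_le
  dual V := by simp [ModalAlgebra.box]
  mp φ ψ h1 h2 V := by simpa [h1 V] using h2 V
  nec φ h V := by simp [h V, ModalAlgebra.box_top]
  subst σ φ h V := by rw [eval_subst]; exact h _

lemma isLogic_addFormulas (L₀ Ψ : Set Formula) : IsLogic (addFormulas L₀ Ψ) where
  taut φ h _ hL _ := hL.taut φ h
  axiomK _ hL _ := hL.axiomK
  dual _ hL _ := hL.dual
  mp φ ψ h1 h2 L hL hs := hL.mp φ ψ (h1 L hL hs) (h2 L hL hs)
  nec φ h L hL hs := hL.nec φ (h L hL hs)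
  subst σ φ h L hL hs := hL.subst σ φ (h L hL hs)

lemma subset_addFormulas (L₀ Ψ : Set Formula) : L₀ ∪ Ψ ⊆ addFormulas L₀ Ψ :=
  fun _ h _ _ hs => hs h

lemma addFormulas_subset {L₀ Ψ L : Set Formula} (hL : IsLogic L) (h₀ : L₀ ⊆ L) (h : Ψ ⊆ L) :
    addFormulas L₀ Ψ ⊆ L :=
  fun _ hφ => hφ L hL (Set.union_subset h₀ h)

lemma IsLogic.logicK_subset {L : Set Formula} (hL : IsLogic L) : logicK ⊆ L :=
  addFormulas_subset hL (Set.empty_subset _) (Set.empty_subset _)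

lemma isAlgebraOf_logicK4_iff {m : ℕ} {A : Type*} [ModalAlgebra A] :
    IsAlgebraOf (logicK4 m) A ↔ ModalAlgebra.IsPreTransitive m A := by
  constructor
  · intro h a
    have := h _ (subset_addFormulas _ _ (Or.inr rfl)) (fun _ => a)
    simpa using this
  · intro h
    refine addFormulas_subset (isLogic_validates A) (isLogic_validates A).logicK_subset ?_
    rintro _ rfl V
    simpa using h (V 0)

/-! ## Subformulas -/

lemma self_mem_sub (φ : Formula) : φ ∈ φ.sub := by
  cases φ <;> simp [Formula.sub]

lemma sub_subset_of_mem {φ ψ : Formula} (h : ψ ∈ φ.sub) : ψ.sub ⊆ φ.sub := by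
  induction φ with
  | var p => rw [Formula.sub, Finset.mem_singleton] at h; rw [h]
  | bot => rw [Formula.sub, Finset.mem_singleton] at h; rw [h]
  | neg φ ih =>
    rw [Formula.sub, Finset.mem_insert] at h
    rcases h with rfl | h
    · rfl
    · exact (ih h).trans (Finset.subset_insert _ _)
  | or φ χ ih1 ih2 =>
    rw [Formula.sub, Finset.mem_insert, Finset.mem_union] at h
    rcases h with rfl | h | h
    · rfl
    · exact ((ih1 h).trans Finset.subset_union_left).trans (Finset.subset_insert _ _)
    · exact ((ih2 h).trans Finset.subset_union_right).trans (Finset.subset_insert _ _)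
  | dia φ ih =>
    rw [Formula.sub, Finset.mem_insert] at h
    rcases h with rfl | h
    · rfl
    · exact (ih h).trans (Finset.subset_insert _ _)

lemma subformulaClosed_sub (φ : Formula) : SubformulaClosed φ.sub := fun _ => sub_subset_of_mem

lemma subformulaClosed_subs (Θ : Finset Formula) : SubformulaClosed (subs Θ) := by
  intro φ hφ
  obtain ⟨χ, hχ, h⟩ := Finset.mem_biUnion.1 hφ
  exact (sub_subset_of_mem h).trans (Finset.subset_biUnion_of_mem _ hχ)

lemma subset_subs (Θ : Finset Formula) : Θ ⊆ subs Θ := fun φ hφ =>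
  Finset.mem_biUnion.2 ⟨φ, hφ, self_mem_sub φ⟩

lemma diaPow_mem_sub {j n : ℕ} (h : j ≤ n) (φ : Formula) : diaPow j φ ∈ (diaPow n φ).sub := by
  induction n, h using Nat.le_induction with
  | base => exact self_mem_sub _
  | succ n _ ih =>
    rw [diaPow, Function.iterate_succ_apply']
    exact Finset.mem_insert_of_mem ih

/-- The bound is m + 1 and not m because ◇^m is applied to ◇φ, itself a member of Θ. -/
lemma diaPow_mem_gabbaySet {m j : ℕ} {Θ : Finset Formula} {φ : Formula} (h : dia φ ∈ Θ)
    (hj : j ≤ m + 1) : diaPow j φ ∈ gabbaySet m Θ := by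
  refine Finset.mem_biUnion.2 ⟨diaPow (m + 1) φ, Finset.mem_union_right _ ?_, diaPow_mem_sub hj φ⟩
  exact Finset.mem_image.2 ⟨_, h, (Function.iterate_succ_apply _ _ _).symm⟩

/-! ## Gabbay's filtration -/

section Gabbay

variable {A : Type*} [ModalAlgebra A]

section Subalgebra

variable (S : BooleanSubalgebra A) [Finite S]

lemma gabbayDia₀_mono : Monotone (gabbayDia₀ S) := fun a b h => by
  rw [← sup_eq_right.2 h, gabbayDia₀_sup]
  exact le_sup_left

lemma dia_le_gabbayDia₀ (a : S) : ModalAlgebra.dia (a : A) ≤ (gabbayDia₀ S a : A) :=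
  (gabbayDia₀_le_iff S a _).1 le_rfl

lemma coe_gabbayDia₀_of_mem {a : S} (h : ModalAlgebra.dia (a : A) ∈ S) :
    (gabbayDia₀ S a : A) = ModalAlgebra.dia (a : A) :=
  le_antisymm ((gabbayDia₀_le_iff S a ⟨_, h⟩).2 le_rfl) (dia_le_gabbayDia₀ S a)

lemma coe_gabbayDia₀_iterate_of_mem {n : ℕ} {a : S}
    (h : ∀ j ≤ n, ModalAlgebra.dia^[j] (a : A) ∈ S) :
    ((gabbayDia₀ S)^[n] a : A) = ModalAlgebra.dia^[n] (a : A) := by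
  induction n with
  | zero => rfl
  | succ n ih =>
    have h' := ih fun j hj => h j (by omega)
    rw [Function.iterate_succ_apply', Function.iterate_succ_apply', ← h',
      coe_gabbayDia₀_of_mem]
    rw [h', ← Function.iterate_succ_apply' ModalAlgebra.dia]
    exact h _ le_rfl

lemma gabbayDia₀_le_gabbayDia₁ (m : ℕ) (a : S) : gabbayDia₀ S a ≤ gabbayDia₁ m S a := by
  simpa using (gabbayDia₁_le_iff m S a _).1 le_rfl 0

lemma gabbayDia₀_iterate_finSup_le_iff (n : ℕ) (s : Set S) (b : S) :
    (gabbayDia₀ S)^[n] (finSup s) ≤ b ↔ ∀ x ∈ s, (gabbayDia₀ S)^[n] x ≤ b := by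
  rw [finSup, Finset.apply_sup_eq_sup_comp _ (gabbayDia₀_iterate_sup S n)
    (gabbayDia₀_iterate_bot S n), Finset.sup_le_iff]
  simp

/-- Each ◇₁ is a finite join and ◇₀ preserves finite joins, so the composite is a join of powers of
◇₀. Every ◇₁ contributes 1 plus a multiple of m to the exponent, for a total of n + km + j. -/
lemma gabbayDia₀_iterate_gabbayDia₁_iterate_le (m n j : ℕ) (a b : S)
    (h : ∀ k, (gabbayDia₀ S)^[n + k * m + j] a ≤ b) :
    (gabbayDia₀ S)^[n] ((gabbayDia₁ m S)^[j] a) ≤ b := by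
  induction j generalizing a with
  | zero => simpa using h 0
  | succ j ih =>
    rw [Function.iterate_succ_apply]
    refine ih _ fun k => ?_
    rw [gabbayDia₁, gabbayDia₀_iterate_finSup_le_iff]
    rintro _ ⟨l, rfl⟩
    rw [← Function.iterate_add_apply]
    convert h (k + l) using 2
    ring

lemma gabbayDia₁_iterate_succ_le (m : ℕ) (a : S) :
    (gabbayDia₁ m S)^[m + 1] a ≤ gabbayDia₁ m S a := by
  refine gabbayDia₀_iterate_gabbayDia₁_iterate_le S m 0 (m + 1) a _ fun k => ?_
  -- The exponent km + (m + 1) equals (k + 1)m + 1, so it occurs in the join defining ◇₁.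
  convert (gabbayDia₁_le_iff m S a _).1 le_rfl (k + 1) using 2
  ring

/-- The hypothesis lets any m extra applications of ◇₀ be dropped as long as at least one remains,
so only the terms with k = 0 count. -/
lemma gabbayDia₁_iterate_eq {m : ℕ} {a : S}
    (h : (gabbayDia₀ S)^[m + 1] a ≤ gabbayDia₀ S a) (j : ℕ) :
    (gabbayDia₁ m S)^[j + 1] a = (gabbayDia₀ S)^[j + 1] a := by
  refine le_antisymm ?_ ?_
  · refine gabbayDia₀_iterate_gabbayDia₁_iterate_le S m 0 (j + 1) a _ fun k => ?_
    rw [zero_add]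
    induction k with
    | zero => simp
    | succ k ih =>
      refine le_trans ?_ ih
      have := (gabbayDia₀_mono S).iterate (k * m + j) h
      rw [← Function.iterate_add_apply, ← Function.iterate_succ_apply] at this
      convert this using 2
      · ring
      · rw [Nat.succ_eq_add_one, add_assoc]
  · exact (gabbayDia₀_mono S).iterate_le_of_le (gabbayDia₀_le_gabbayDia₁ S m) _ a

end Subalgebra

variable (m : ℕ) (V : ℕ → A) (Θ : Finset Formula)

lemma eval_mem_gabbaySubalgebra {V : ℕ → A} {Θ : Finset Formula} {φ : Formula}
    (h : φ ∈ gabbaySet m Θ) : eval V φ ∈ gabbaySubalgebra m V Θ :=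
  BooleanSubalgebra.subset_closure ⟨φ, h, rfl⟩

lemma isPreTransitive_gabbayAlgebra :
    ModalAlgebra.IsPreTransitive m (GabbayAlgebra m V Θ) :=
  gabbayDia₁_iterate_succ_le (gabbaySubalgebra m V Θ) m

lemma isStable_gabbayInclusion : IsStable (gabbayInclusion m V Θ) := fun a =>
  (dia_le_gabbayDia₀ (gabbaySubalgebra m V Θ) a).trans
    (gabbayDia₀_le_gabbayDia₁ (gabbaySubalgebra m V Θ) m a)

lemma satisfiesMCDC_gabbayInclusion (hA : ModalAlgebra.IsPreTransitive m A) :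
    SatisfiesMCDC m (gabbayInclusion m V Θ) (closedDomain V Θ (gabbayInclusion m V Θ)) := by
  rintro a ⟨φ, hφ, ha⟩ k hk1 hkm
  let S := gabbaySubalgebra m V Θ
  -- The range goes one beyond m: the case j = m + 1 is what transfers pre-transitivity at a from A
  -- to ◇₀.
  have key : ∀ j, j ≤ m + 1 → (((gabbayDia₀ S)^[j] (a : S) : S) : A) =
      ModalAlgebra.dia^[j] (gabbayInclusion m V Θ a) := fun j hj =>
    coe_gabbayDia₀_iterate_of_mem S fun i hi => by
      change ModalAlgebra.dia^[i] (gabbayInclusion m V Θ a) ∈ S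
      rw [ha, ← eval_diaPow]
      exact eval_mem_gabbaySubalgebra m (diaPow_mem_gabbaySet hφ (hi.trans hj))
  have h : (gabbayDia₀ S)^[m + 1] (a : S) ≤ gabbayDia₀ S a := by
    refine Subtype.coe_le_coe.1 ?_
    rw [key _ le_rfl]
    refine (hA _).trans ?_
    exact (key 1 (by omega)).ge
  obtain ⟨j, rfl⟩ : ∃ j, k = j + 1 := ⟨k - 1, by omega⟩
  rw [← key _ (by omega), ← gabbayDia₁_iterate_eq S h]
  rfl

lemma exists_isDefinableFiltration_gabbay (hm : 1 ≤ m)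
    (hA : ModalAlgebra.IsPreTransitive m A) (hΘ : SubformulaClosed Θ) :
    ∃ V' : ℕ → GabbayAlgebra m V Θ,
      IsDefinableFiltration V Θ (gabbaySet m Θ) (gabbayInclusion m V Θ) V' := by
  have h : ∀ p, ∃ b : GabbayAlgebra m V Θ,
      (var p ∈ gabbaySet m Θ → gabbayInclusion m V Θ b = V p) ∧
        (var p ∉ gabbaySet m Θ → b = ⊥) := by
    intro p
    by_cases hp : var p ∈ gabbaySet m Θ
    · exact ⟨⟨_, eval_mem_gabbaySubalgebra m hp⟩, fun _ => rfl, fun h => absurd hp h⟩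
    · exact ⟨⊥, fun h => absurd h hp, fun _ => rfl⟩
  choose V' h1 h2 using h
  exact ⟨V', hΘ, subformulaClosed_subs _, Finset.subset_union_left.trans (subset_subs _),
    Subtype.val_injective, Subtype.range_coe, h1, h2, isStable_gabbayInclusion m V Θ,
    fun a ha => satisfiesMCDC_gabbayInclusion m V Θ hA a ha 1 le_rfl hm⟩

end Gabbay

/-! ## Subdirectly irreducible algebras -/

lemma exists_rel_ne_of_ne_bot {A : Type*} {r : Setoid A} (h : r ≠ ⊥) : ∃ a b, r a b ∧ a ≠ b := by
  by_contra! h'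
  exact h (le_bot_iff.1 fun a b hab => h' a b hab)

section SI

variable {A : Type*} [ModalAlgebra A]

lemma IsCongruence.inf {r : Setoid A} (hr : IsCongruence r) {a a' b b' : A} (h1 : r a a')
    (h2 : r b b') : r (a ⊓ b) (a' ⊓ b') := by
  have := hr.compl _ _ (hr.sup _ _ _ _ (hr.compl _ _ h1) (hr.compl _ _ h2))
  simpa using this

lemma IsCongruence.bihimp_top {r : Setoid A} (hr : IsCongruence r) {a b : A} (h : r a b) :
    r (bihimp a b) ⊤ := by
  have h1 := hr.inf (hr.sup _ _ _ _ h (r.refl bᶜ)) (hr.sup _ _ _ _ (r.refl b) (hr.compl _ _ h))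
  simpa [bihimp_eq] using h1

lemma IsCongruence.box {r : Setoid A} (hr : IsCongruence r) {a b : A} (h : r a b) :
    r (ModalAlgebra.box a) (ModalAlgebra.box b) :=
  hr.compl _ _ (hr.dia _ _ (hr.compl _ _ h))

lemma IsCongruence.boxLe {r : Setoid A} (hr : IsCongruence r) {a b : A} (h : r a b) (k : ℕ) :
    r (ModalAlgebra.boxLe k a) (ModalAlgebra.boxLe k b) := by
  have h1 : ∀ n, r (ModalAlgebra.box^[n] a) (ModalAlgebra.box^[n] b) := by
    intro n
    induction n with
    | zero => exact h
    | succ n ih => simp only [Function.iterate_succ_apply']; exact hr.box ih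
  induction k with
  | zero => exact h
  | succ k ih => exact hr.inf ih (h1 _)

/-- A congruence identifying distinct a and b identifies a ⇔ b ≠ ⊤ with ⊤, hence also its □^{≤m};
joining with c gives c ~ ⊤. So the pair (c, ⊤) survives in the intersection of all nontrivial
congruences. -/
lemma isSubdirectlyIrreducible_of_isOpremum {m : ℕ} {c : A} (hc : ModalAlgebra.IsOpremum m c) :
    IsSubdirectlyIrreducible A := by
  refine ⟨sInf {r | IsCongruence r ∧ r ≠ ⊥}, ⟨?_, ?_, ?_⟩, ?_, fun r h1 h2 => sInf_le ⟨h1, h2⟩⟩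
  · exact fun a a' b b' h1 h2 r hr => hr.1.sup _ _ _ _ (h1 r hr) (h2 r hr)
  · exact fun a a' h r hr => hr.1.compl _ _ (h r hr)
  · exact fun a a' h r hr => hr.1.dia _ _ (h r hr)
  · intro h
    have : sInf {r : Setoid A | IsCongruence r ∧ r ≠ ⊥} c ⊤ := by
      rintro r ⟨hr, hne⟩
      obtain ⟨a, b, hab, hne⟩ := exists_rel_ne_of_ne_bot hne
      have h1 := hr.boxLe (hr.bihimp_top hab) m
      rw [ModalAlgebra.boxLe_top] at h1
      have h2 := hr.sup _ _ _ _ h1 (r.refl c)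
      rwa [top_sup_eq, sup_eq_right.2 (hc.2 _ fun h' => hne (bihimp_eq_top.1 h'))] at h2
    rw [h] at this
    exact hc.1 this

/-- Relativization to x; openness is needed only for compatibility with ◇. -/
lemma isCongruence_of_le_box {x : A} (hx : x ≤ ModalAlgebra.box x) :
    IsCongruence (Setoid.ker fun a : A => x ⊓ a) := by
  have key : ∀ {a b : A}, x ⊓ a = x ⊓ b ↔ x ≤ a ⇨ b ∧ x ≤ b ⇨ a := by
    intro a b
    rw [le_himp_iff, le_himp_iff, le_antisymm_iff, le_inf_iff, le_inf_iff]
    simp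
  refine ⟨fun a a' b b' h1 h2 => ?_, fun a a' h => ?_, fun a a' h => ?_⟩
  · change x ⊓ a = x ⊓ a' at h1
    change x ⊓ b = x ⊓ b' at h2
    change x ⊓ (a ⊔ b) = x ⊓ (a' ⊔ b')
    rw [inf_sup_left, inf_sup_left, h1, h2]
  · change x ⊓ a = x ⊓ a' at h
    change x ⊓ aᶜ = x ⊓ a'ᶜ
    rw [← sdiff_eq, ← sdiff_eq, ← sdiff_inf_self_left, h, sdiff_inf_self_left]
  · obtain ⟨h1, h2⟩ := key.1 h
    exact key.2 ⟨ModalAlgebra.le_dia_himp_dia hx h1, ModalAlgebra.le_dia_himp_dia hx h2⟩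

/-- The opremum is a ⇔ b for any distinct a, b identified by the least nontrivial congruence μ. For
d ≠ ⊤, relativization to the open element □^{≤m}d identifies d with ⊤, so it contains μ and
identifies a ⇔ b with ⊤, which means □^{≤m}d ≤ a ⇔ b. -/
lemma IsSubdirectlyIrreducible.exists_isOpremum {m : ℕ} (hm : 1 ≤ m)
    (hA : ModalAlgebra.IsPreTransitive m A) (h : IsSubdirectlyIrreducible A) :
    ∃ c : A, ModalAlgebra.IsOpremum m c := by
  obtain ⟨μ, hμ, hne, hle⟩ := h
  obtain ⟨a, b, hab, hne⟩ := exists_rel_ne_of_ne_bot hne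
  refine ⟨bihimp a b, fun h' => hne (bihimp_eq_top.1 h'), fun d hd => ?_⟩
  have h1 := hle _ (isCongruence_of_le_box (hA.boxLe_le_box hm d)) (fun h' => ?_)
    (hμ.bihimp_top hab)
  · change _ ⊓ _ = _ ⊓ _ at h1
    rw [inf_top_eq] at h1
    exact inf_eq_left.1 h1
  · have h2 : (Setoid.ker fun a : A => ModalAlgebra.boxLe m d ⊓ a) d ⊤ := by
      change _ ⊓ _ = _ ⊓ _
      rw [inf_top_eq, inf_eq_left]
      exact ModalAlgebra.boxLe_le_self m d
    rw [h'] at h2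
    exact hd h2

variable {B : Type*} [ModalAlgebra B]

lemma map_box_le_of_isStable {h : BoundedLatticeHom A B} (hs : IsStable h) (a : A) :
    h (ModalAlgebra.box a) ≤ ModalAlgebra.box (h a) := by
  rw [ModalAlgebra.box, ModalAlgebra.box, map_compl', ← map_compl' h a]
  exact compl_le_compl (hs _)

lemma map_boxLe_le_of_isStable {h : BoundedLatticeHom A B} (hs : IsStable h) (k : ℕ) (a : A) :
    h (ModalAlgebra.boxLe k a) ≤ ModalAlgebra.boxLe k (h a) := by
  have h1 : ∀ n, h (ModalAlgebra.box^[n] a) ≤ ModalAlgebra.box^[n] (h a) := by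
    intro n
    induction n with
    | zero => exact le_rfl
    | succ n ih =>
      simp only [Function.iterate_succ_apply']
      exact (map_box_le_of_isStable hs _).trans (ModalAlgebra.box_mono ih)
  induction k with
  | zero => exact le_rfl
  | succ k ih =>
    rw [ModalAlgebra.boxLe, map_inf]
    exact inf_le_inf ih (h1 _)

/-- A finite algebra that is stably embedded into an algebra with an opremum has an opremum. -/
lemma exists_isOpremum_of_isStable [Finite A] {m : ℕ} {c : B} (hc : ModalAlgebra.IsOpremum m c)
    {h : BoundedLatticeHom A B} (hi : Function.Injective h) (hs : IsStable h) :
    ∃ d : A, ModalAlgebra.IsOpremum m d := by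
  -- By finiteness the join of all these elements exists; it is the least candidate, and it differs
  -- from ⊤ because its image stays below c.
  let s : Finset A := (Set.toFinite {x : A | ∃ a ≠ ⊤, x = ModalAlgebra.boxLe m a}).toFinset
  have hsc : h (s.sup id) ≤ c := by
    rw [map_finset_sup, Finset.sup_le_iff]
    intro x hx
    obtain ⟨a, ha, rfl⟩ : ∃ a ≠ ⊤, x = ModalAlgebra.boxLe m a := by simpa [s] using hx
    exact (map_boxLe_le_of_isStable hs m a).trans
      (hc.2 _ fun h' => ha (hi (h'.trans (map_top h).symm)))
  refine ⟨s.sup id, fun h' => ?_, fun a ha => ?_⟩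
  · rw [h', map_top, top_le_iff] at hsc
    exact hc.1 hsc
  · exact Finset.le_sup (f := id) (by simpa [s] using ⟨a, ha, rfl⟩)

end SI

/-! ## The size of finitely generated Boolean subalgebras -/

section Card

variable {A : Type*} [BooleanAlgebra A]

lemma _root_.IsAtom.le_sup_iff {a b c : A} (ha : IsAtom a) : a ≤ b ⊔ c ↔ a ≤ b ∨ a ≤ c := by
  simp only [← ha.not_disjoint_iff_le, disjoint_sup_right, not_and_or]

lemma _root_.IsAtom.le_compl_iff {a b : A} (ha : IsAtom a) : a ≤ bᶜ ↔ ¬ a ≤ b := by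
  rw [le_compl_iff_disjoint_right, ha.not_le_iff_disjoint]

/-- An atom of the generated subalgebra is determined by the set of generators above it, and an
element by the atoms below it. This gives an injection into the sets of sets of generators. -/
lemma natCard_closure_le (s : Finset A) [Finite (BooleanSubalgebra.closure (s : Set A))] :
    Nat.card (BooleanSubalgebra.closure (s : Set A)) ≤ 2 ^ 2 ^ s.card := by
  let S := BooleanSubalgebra.closure (s : Set A)
  let t : S → Set s := fun α => {g | (α : A) ≤ g}
  have key : ∀ α β : S, IsAtom α → IsAtom β → t α = t β → ∀ x : S, α ≤ x ↔ β ≤ x := by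
    rintro α β hα hβ h ⟨x, hx⟩
    induction hx using BooleanSubalgebra.closure_bot_sup_induction with
    | mem x hx => exact Set.ext_iff.1 h ⟨x, hx⟩
    | bot =>
      change α ≤ ⊥ ↔ β ≤ ⊥
      simp [hα.1, hβ.1]
    | sup x hx y hy ihx ihy =>
      change α ≤ (⟨x, hx⟩ ⊔ ⟨y, hy⟩ : S) ↔ β ≤ (⟨x, hx⟩ ⊔ ⟨y, hy⟩ : S)
      rw [hα.le_sup_iff, hβ.le_sup_iff, ihx, ihy]
    | compl x hx ih =>
      change α ≤ (⟨x, hx⟩ : S)ᶜ ↔ β ≤ (⟨x, hx⟩ : S)ᶜ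
      rw [hα.le_compl_iff, hβ.le_compl_iff, ih]
  let f : S → Set (Set s) := fun x => t '' {α | IsAtom α ∧ α ≤ x}
  have hle : ∀ x y, f x ⊆ f y → x ≤ y := by
    intro x y h
    refine BooleanAlgebra.le_iff_atom_le_imp.2 fun α hα hx => ?_
    obtain ⟨β, ⟨hβ, hy⟩, hβα⟩ := h ⟨α, ⟨hα, hx⟩, rfl⟩
    exact (key β α hβ hα hβα y).1 hy
  have hf : Function.Injective f := fun x y h => le_antisymm (hle x y h.le) (hle y x h.ge)
  simpa [Nat.card_eq_fintype_card] using Nat.card_le_card_of_injective f hf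

end Card

/-! ## Transport of modal algebras along bijections -/

section Transport

variable {X A : Type*} [ModalAlgebra A]

/-- Transport of a modal algebra structure along a bijection. -/
abbrev modalAlgebraOfEquiv (e : X ≃ A) : ModalAlgebra X where
  __ := e.booleanAlgebra
  dia x := e.symm (ModalAlgebra.dia (e x))
  dia_bot := by
    rw [Equiv.symm_apply_eq]
    change ModalAlgebra.dia (e (e.symm ⊥)) = e (e.symm ⊥)
    rw [e.apply_symm_apply, ModalAlgebra.dia_bot]
  dia_sup a b := by
    rw [Equiv.symm_apply_eq]
    change ModalAlgebra.dia (e (e.symm (e a ⊔ e b))) = e (e.symm (e (e.symm _) ⊔ e (e.symm _)))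
    simp only [e.apply_symm_apply, ModalAlgebra.dia_sup]

end Transport

lemma exists_modalAlgebra_of_equiv {X A : Type*} [ModalAlgebra A] (e : X ≃ A) :
    ∃ (_ : ModalAlgebra X) (i : BoundedLatticeHom X A), (∀ x, i x = e x) ∧
      ∀ x, i (ModalAlgebra.dia x) = ModalAlgebra.dia (i x) := by
  let _ := modalAlgebraOfEquiv e
  refine ⟨inferInstance, ⟨⟨⟨e, fun a b => ?_⟩, fun a b => ?_⟩, ?_, ?_⟩, fun _ => rfl,
    fun x => ?_⟩ <;>
  exact e.apply_symm_apply _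

/-! ## Evaluation along maps that respect the structure up to a congruence -/

section Eval

variable {A B : Type*} [ModalAlgebra A] [ModalAlgebra B]

/-- Working modulo r covers two uses at once: the filtration lemma, with r the identity, and the
argument relative to an open premise, where a ↦ p_a is a homomorphism only modulo that premise. -/
lemma IsCongruence.eval_rel {r : Setoid B} (hr : IsCongruence r) {g : A → B}
    (hsup : ∀ a b, r (g (a ⊔ b)) (g a ⊔ g b)) (hcompl : ∀ a, r (g aᶜ) (g a)ᶜ)
    {Θ : Finset Formula} (hΘ : SubformulaClosed Θ) {V : ℕ → A} {U : ℕ → B}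
    (hvar : ∀ p, var p ∈ Θ → r (U p) (g (V p)))
    (hdia : ∀ ψ : Formula, Formula.dia ψ ∈ Θ → r (eval U ψ) (g (eval V ψ)) →
      r (ModalAlgebra.dia (g (eval V ψ))) (g (ModalAlgebra.dia (eval V ψ))))
    {ψ : Formula} (hψ : ψ ∈ Θ) : r (eval U ψ) (g (eval V ψ)) := by
  induction ψ with
  | var p => exact hvar p hψ
  | bot =>
    -- No assumption mentions constants: g ⊤ is recovered from ⊤ = ⊥ ⊔ ⊥ᶜ, and then g ⊥ by
    -- complementation.
    have h1 : r (g ⊤) ⊤ := by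
      have h := r.trans (hsup ⊥ ⊥ᶜ) (hr.sup _ _ _ _ (r.refl _) (hcompl ⊥))
      simpa using h
    have h2 := r.trans (hcompl ⊤) (hr.compl _ _ h1)
    simp only [compl_top] at h2
    exact r.symm h2
  | neg ψ ih =>
    have h := ih (hΘ _ hψ (Finset.mem_insert_of_mem (self_mem_sub ψ)))
    exact r.trans (hr.compl _ _ h) (r.symm (hcompl _))
  | or ψ χ ih1 ih2 =>
    have h1 := ih1 (hΘ _ hψ (Finset.mem_insert_of_mem (Finset.mem_union_left _ (self_mem_sub ψ))))
    have h2 := ih2 (hΘ _ hψ (Finset.mem_insert_of_mem (Finset.mem_union_right _ (self_mem_sub χ))))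
    exact r.trans (hr.sup _ _ _ _ h1 h2) (r.symm (hsup _ _))
  | dia ψ ih =>
    have h := ih (hΘ _ hψ (Finset.mem_insert_of_mem (self_mem_sub ψ)))
    exact r.trans (hr.dia _ _ h) (hdia ψ hψ h)

/-- The filtration lemma. -/
lemma map_eval_of_satisfiesCDC {h : BoundedLatticeHom A B} {Θ : Finset Formula}
    (hΘ : SubformulaClosed Θ) {V : ℕ → A} {U : ℕ → B} (hvar : ∀ p, var p ∈ Θ → h (V p) = U p)
    (hcdc : SatisfiesCDC h (closedDomain U Θ h)) {ψ : Formula} (hψ : ψ ∈ Θ) :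
    h (eval V ψ) = eval U ψ := by
  have hr : IsCongruence (⊥ : Setoid B) := by
    refine ⟨fun a a' b b' h1 h2 => ?_, fun a a' h1 => ?_, fun a a' h1 => ?_⟩
    · obtain rfl : a = a' := h1
      obtain rfl : b = b' := h2
      rfl
    · obtain rfl : a = a' := h1
      rfl
    · obtain rfl : a = a' := h1
      rfl
  exact (hr.eval_rel (g := h) (fun a b => map_sup h a b) (fun a => map_compl' h a) hΘ
    (fun p hp => (hvar p hp).symm)
    (fun χ hχ h1 => (hcdc _ ⟨χ, hχ, Eq.symm h1⟩).symm) hψ : eval U ψ = h (eval V ψ)).symm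

end Eval

/-! ## Refuting and validating `m`-stable canonical formulas -/

section Canonical

variable {A B : Type*} [ModalAlgebra A] [ModalAlgebra B] [Fintype A] {m : ℕ} {D : Finset A}

lemma mem_mscPremises_iff {p : A → ℕ} {γ : Formula} : γ ∈ mscPremises m D p ↔
    (∃ a b, Formula.iff (var (p (a ⊔ b))) (Formula.or (var (p a)) (var (p b))) = γ) ∨
    (∃ a, Formula.iff (var (p aᶜ)) (neg (var (p a))) = γ) ∨
    (∃ a, imp (dia (var (p a))) (var (p (ModalAlgebra.dia a))) = γ) ∨
    (∃ a k, (a ∈ D ∧ 1 ≤ k ∧ k ≤ m) ∧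
      imp (var (p (ModalAlgebra.dia^[k] a))) (diaPow k (var (p a))) = γ) := by
  simp [mscPremises]

lemma mem_mscConclusions_iff {p : A → ℕ} {δ : Formula} :
    δ ∈ mscConclusions p ↔ ∃ a, a ≠ ⊤ ∧ var (p a) = δ := by
  simp [mscConclusions]

/-- A stable embedding of `A` satisfying the closed domain condition for `D` yields a refutation of
`γ_+^m(A, D)`. -/
lemma not_validates_mStableCanonicalFormula {c : B} (hc : ModalAlgebra.IsOpremum m c)
    {h : BoundedLatticeHom A B} (hi : Function.Injective h) (hs : IsStable h)
    (hD : SatisfiesMCDC m h D) (p : A ↪ ℕ) :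
    ¬ Validates B (mStableCanonicalFormula m D p) := by
  intro hv
  -- Interpreting p_a as h(a) makes every premise ⊤, while injectivity of h keeps each □^{≤m}p_a
  -- with a ≠ ⊤ below c. Variables outside the range of p are irrelevant.
  let W : ℕ → B := Function.extend p h ⊥
  have hW : ∀ a, W (p a) = h a := p.injective.extend_apply _ _
  have hΓ : ∀ γ ∈ mscPremises m D p, eval W γ = ⊤ := by
    intro γ hγ
    rcases mem_mscPremises_iff.1 hγ with ⟨a, b, rfl⟩ | ⟨a, rfl⟩ | ⟨a, rfl⟩ |
      ⟨a, k, ⟨ha, h1, h2⟩, rfl⟩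
    · simp [hW]
    · simp [hW]
    · simpa [hW] using hs a
    · simpa [hW] using (hD a ha k h1 h2).le
  have h1 := hv W
  rw [mStableCanonicalFormula, eval_imp, himp_eq_top_iff] at h1
  have h2 : ⊤ ≤ eval W (conj ((mscPremises m D p).image (boxLe m))) := by
    rw [le_eval_conj_iff]
    intro γ' hγ'
    obtain ⟨γ, hγ, rfl⟩ := Finset.mem_image.1 hγ'
    rw [eval_boxLe, hΓ γ hγ, ModalAlgebra.boxLe_top]
  have h3 : eval W (disj ((mscConclusions p).image (boxLe m))) ≤ c := by
    rw [eval_disj_le_iff]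
    intro δ' hδ'
    obtain ⟨δ, hδ, rfl⟩ := Finset.mem_image.1 hδ'
    obtain ⟨a, ha, rfl⟩ := mem_mscConclusions_iff.1 hδ
    rw [eval_boxLe, eval_var, hW]
    exact hc.2 _ fun h' => ha (hi (h'.trans (map_top h).symm))
  exact hc.1 (top_le_iff.1 ((h2.trans h1).trans h3))

lemma le_box_eval_conj (W : ℕ → B) {Γ : Finset Formula}
    (h : ∀ γ ∈ Γ, eval W γ ≤ ModalAlgebra.box (eval W γ)) :
    eval W (conj Γ) ≤ ModalAlgebra.box (eval W (conj Γ)) := by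
  have key : ∀ l : List Formula, (∀ γ ∈ l, eval W γ ≤ ModalAlgebra.box (eval W γ)) →
      eval W (l.foldr Formula.and top) ≤ ModalAlgebra.box (eval W (l.foldr Formula.and top)) := by
    intro l
    induction l with
    | nil => simp [ModalAlgebra.box_top]
    | cons γ l ih =>
      intro hl
      simp only [List.foldr_cons, eval_and, ModalAlgebra.box_inf]
      exact inf_le_inf (hl γ (by simp)) (ih fun γ' h' => hl γ' (by simp [h']))
  exact key _ fun γ hγ => h γ (Finset.mem_toList.1 hγ)

/-- If `A` refutes `φ` and `D` is large enough, then all pre-transitive algebras that validate `φ`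
also validate `γ_+^m(A, D)`. -/
lemma validates_mStableCanonicalFormula (hm : 1 ≤ m) (hB : ModalAlgebra.IsPreTransitive m B)
    {φ : Formula} (hφ : Validates B φ) {V : ℕ → A} (hV : eval V φ ≠ ⊤)
    (hD : ∀ ψ, dia ψ ∈ φ.sub → eval V ψ ∈ D) (p : A → ℕ) :
    Validates B (mStableCanonicalFormula m D p) := by
  intro W
  rw [mStableCanonicalFormula, eval_imp, himp_eq_top_iff]
  set x := eval W (conj ((mscPremises m D p).image (boxLe m))) with hx
  have hxbox : x ≤ ModalAlgebra.box x := by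
    refine le_box_eval_conj W fun γ' hγ' => ?_
    obtain ⟨γ, hγ, rfl⟩ := Finset.mem_image.1 hγ'
    rw [eval_boxLe]
    exact hB.boxLe_le_box hm _
  have hΓ : ∀ γ ∈ mscPremises m D p, x ≤ eval W γ := by
    intro γ hγ
    have := (le_eval_conj_iff W _).1 hx.le _ (Finset.mem_image_of_mem (boxLe m) hγ)
    rw [eval_boxLe] at this
    exact this.trans (ModalAlgebra.boxLe_le_self _ _)
  have hr := isCongruence_of_le_box hxbox
  have hrel : ∀ {a b : B}, x ≤ a ⇨ b → x ≤ b ⇨ a → Setoid.ker (fun a : B => x ⊓ a) a b := by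
    intro a b h1 h2
    rw [le_himp_iff] at h1 h2
    exact le_antisymm (le_inf inf_le_left h1) (le_inf inf_le_left h2)
  have hiff : ∀ {α β : Formula}, Formula.iff α β ∈ mscPremises m D p →
      Setoid.ker (fun a : B => x ⊓ a) (eval W α) (eval W β) := by
    intro α β h
    have h' := hΓ _ h
    rw [eval_iff, bihimp, le_inf_iff] at h'
    exact hrel h'.2 h'.1
  -- The refutation V on A is pulled into B along a ↦ p_a. Of the closed domain premises only the
  -- case k = 1 is used.
  have h1 := hr.eval_rel (g := fun a => W (p a)) (U := fun q => W (p (V q))) (V := V)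
    (fun a b => hiff (mem_mscPremises_iff.2 (Or.inl ⟨a, b, rfl⟩)))
    (fun a => hiff (mem_mscPremises_iff.2 (Or.inr (Or.inl ⟨a, rfl⟩))))
    (subformulaClosed_sub φ) (fun q _ => rfl)
    (fun ψ hψ _ => by
      have h2 := hΓ _ (mem_mscPremises_iff.2 (Or.inr (Or.inr (Or.inl ⟨eval V ψ, rfl⟩))))
      have h3 := hΓ _ (mem_mscPremises_iff.2
        (Or.inr (Or.inr (Or.inr ⟨eval V ψ, 1, ⟨hD ψ hψ, le_rfl, hm⟩, rfl⟩))))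
      rw [eval_imp] at h2 h3
      exact hrel h2 h3)
    (self_mem_sub φ)
  rw [hφ] at h1
  have h2 : x ≤ W (p (eval V φ)) := by
    change x ⊓ ⊤ = x ⊓ W (p (eval V φ)) at h1
    rw [inf_top_eq] at h1
    exact inf_eq_left.1 h1.symm
  have h3 := (eval_disj_le_iff W ((mscConclusions p).image (boxLe m))).1 le_rfl _
    (Finset.mem_image_of_mem (boxLe m) (mem_mscConclusions_iff.2 ⟨_, hV, rfl⟩))
  refine le_trans ?_ h3
  -- Openness gives x = □^{≤m}x, so x ≤ p_{V(φ)} improves to the boxed disjunct.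
  rw [← ModalAlgebra.boxLe_eq_of_le_box (m := m) hxbox, eval_boxLe]
  exact ModalAlgebra.boxLe_mono m h2

end Canonical

/-! ## Finite refutation patterns -/

section Patterns

/-- The `m`-stable canonical formulas `γ_+^m(A, D)` in variables below `N` such that `A` refutes `φ`
under a valuation `V` with `V(ψ) ∈ D` whenever `◇ψ` is a subformula of `φ`. -/
def refutationFormulas (m N : ℕ) (φ : Formula) : Set Formula :=
  {γ | ∃ (A : Type) (_ : ModalAlgebra A) (_ : Fintype A) (D : Finset A) (p : A ↪ ℕ) (V : ℕ → A),
    IsSubdirectlyIrreducible A ∧ IsAlgebraOf (logicK4 m) A ∧ eval V φ ≠ ⊤ ∧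
    (∀ ψ, dia ψ ∈ φ.sub → eval V ψ ∈ D) ∧ (∀ a, p a < N) ∧
    γ = mStableCanonicalFormula m D p}

lemma IsMStableCanonical.of_mem_refutationFormulas {m N : ℕ} {φ γ : Formula}
    (h : γ ∈ refutationFormulas m N φ) : IsMStableCanonical m γ := by
  obtain ⟨A, i1, i2, D, p, V, h1, h2, -, -, -, rfl⟩ := h
  exact ⟨A, i1, i2, D, p, h1, h2, rfl⟩

/-- The count is syntactic: with variables below N, the premises and conclusions range over subsets
of two fixed finite sets of formulas, so algebras need not be counted up to isomorphism. -/
lemma finite_refutationFormulas (m N : ℕ) (φ : Formula) : (refutationFormulas m N φ).Finite := by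
  let R := Finset.range N
  let G : Finset Formula :=
    ((R ×ˢ R ×ˢ R).image fun x =>
      Formula.iff (var x.1) (Formula.or (var x.2.1) (var x.2.2))) ∪
    ((R ×ˢ R).image fun x => Formula.iff (var x.1) (neg (var x.2))) ∪
    ((R ×ˢ R).image fun x => imp (dia (var x.1)) (var x.2)) ∪
    ((R ×ˢ R ×ˢ Finset.Icc 1 m).image fun x => imp (var x.1) (diaPow x.2.2 (var x.2.1)))
  let E : Finset Formula := R.image var
  refine ((G.powerset ×ˢ E.powerset).image fun x : Finset Formula × Finset Formula =>
    imp (conj (x.1.image (boxLe m))) (disj (x.2.image (boxLe m)))).finite_toSet.subset ?_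
  rintro _ ⟨A, _, _, D, p, -, -, -, -, -, hp, rfl⟩
  refine Finset.mem_image.2 ⟨(mscPremises m D p, mscConclusions p), ?_, rfl⟩
  rw [Finset.mem_product, Finset.mem_powerset, Finset.mem_powerset]
  constructor
  · intro γ hγ
    simp only [G, R, Finset.mem_union, Finset.mem_image, Finset.mem_product, Finset.mem_range,
      Finset.mem_Icc, Prod.exists, or_assoc]
    rcases mem_mscPremises_iff.1 hγ with ⟨a, b, rfl⟩ | ⟨a, rfl⟩ | ⟨a, rfl⟩ | ⟨a, k, ⟨-, h⟩, rfl⟩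
    · exact Or.inl ⟨_, _, _, ⟨hp _, hp _, hp _⟩, rfl⟩
    · exact Or.inr (Or.inl ⟨_, _, ⟨hp _, hp _⟩, rfl⟩)
    · exact Or.inr (Or.inr (Or.inl ⟨_, _, ⟨hp _, hp _⟩, rfl⟩))
    · exact Or.inr (Or.inr (Or.inr ⟨_, _, _, ⟨hp _, hp _, h⟩, rfl⟩))
  · intro δ hδ
    obtain ⟨a, -, rfl⟩ := mem_mscConclusions_iff.1 hδ
    exact Finset.mem_image.2 ⟨_, Finset.mem_range.2 (hp a), rfl⟩

lemma validates_of_mem_refutationFormulas {m N : ℕ} (hm : 1 ≤ m) {φ γ : Formula}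
    (h : γ ∈ refutationFormulas m N φ) {B : Type*} [ModalAlgebra B]
    (hB : ModalAlgebra.IsPreTransitive m B) (hφ : Validates B φ) : Validates B γ := by
  obtain ⟨A, _, _, D, p, V, -, -, hV, hD, -, rfl⟩ := h
  exact validates_mStableCanonicalFormula hm hB hφ hV hD p

/-- A bound on the size of Gabbay's filtration for the subformulas of `φ`. -/
def gabbayBound (m : ℕ) (φ : Formula) : ℕ := 2 ^ 2 ^ (gabbaySet m φ.sub).card

lemma natCard_gabbayAlgebra_le {B : Type*} [ModalAlgebra B] (m : ℕ) (V : ℕ → B) (φ : Formula) :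
    Nat.card (GabbayAlgebra m V φ.sub) ≤ gabbayBound m φ := by
  classical
  have h : (((gabbaySet m φ.sub).image (eval V) : Finset B) : Set B) =
      eval V '' (gabbaySet m φ.sub : Set Formula) := Finset.coe_image
  have : Finite (BooleanSubalgebra.closure
      (((gabbaySet m φ.sub).image (eval V) : Finset B) : Set B)) :=
    finite_closure (Finset.finite_toSet _)
  have h1 := natCard_closure_le ((gabbaySet m φ.sub).image (eval V))
  rw [h] at h1
  exact h1.trans (Nat.pow_le_pow_right two_pos
    (Nat.pow_le_pow_right two_pos Finset.card_image_le))

lemma exists_mem_refutationFormulas_not_validates {m : ℕ} (hm : 1 ≤ m) {φ : Formula}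
    {B : Type*} [ModalAlgebra B] (hB : ModalAlgebra.IsPreTransitive m B)
    (hsi : IsSubdirectlyIrreducible B)
    (hφ : ¬ Validates B φ) :
    ∃ γ ∈ refutationFormulas m (gabbayBound m φ) φ, ¬ Validates B γ := by
  classical
  obtain ⟨V, hV⟩ := not_forall.1 hφ
  obtain ⟨c, hc⟩ := hsi.exists_isOpremum hm hB
  let Θ := φ.sub
  obtain ⟨V', hV'⟩ := exists_isDefinableFiltration_gabbay m V Θ hm hB (subformulaClosed_sub φ)
  have : Finite (GabbayAlgebra m V Θ) := finite_gabbaySubalgebra m V Θ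
  let n := Nat.card (GabbayAlgebra m V Θ)
  -- The filtration lives in the universe of B. A copy on `Fin n` brings it into `Type` and supplies
  -- variables below the cardinality bound.
  obtain ⟨X, e, p, _, hp⟩ : ∃ (X : Type) (_ : X ≃ GabbayAlgebra m V Θ) (p : X ↪ ℕ) (_ : Fintype X),
      ∀ a, p a < n :=
    ⟨Fin n, (Finite.equivFin _).symm, Fin.valEmbedding, inferInstance, fun a => a.2⟩
  obtain ⟨_, i, hie, hdia⟩ := exists_modalAlgebra_of_equiv e
  have hi : Function.Injective i := fun a b h => e.injective (by rwa [← hie, ← hie])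
  have hiter : ∀ k x, i (ModalAlgebra.dia^[k] x) = ModalAlgebra.dia^[k] (i x) := fun k x =>
    (Function.Semiconj.iterate_right hdia k) x
  have hX : ModalAlgebra.IsPreTransitive m X := by
    intro a
    have h := isPreTransitive_gabbayAlgebra m V Θ (i a)
    rw [← hiter, ← hdia, ← sup_eq_right, ← map_sup] at h
    exact sup_eq_right.1 (hi h)
  let h : BoundedLatticeHom X B := (gabbayInclusion m V Θ).comp i
  have hinj : Function.Injective h := hV'.injective.comp hi
  have hst : IsStable h := fun a => (hV'.stable (i a)).trans (congrArg _ (hdia a)).ge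
  let D : Finset X := Finset.univ.filter fun x =>
    i x ∈ closedDomain V Θ (gabbayInclusion m V Θ)
  have hD : SatisfiesMCDC m h D := fun a ha k h1 h2 =>
    (congrArg _ (hiter k a)).trans
      (satisfiesMCDC_gabbayInclusion m V Θ hB _ (Finset.mem_filter.1 ha).2 k h1 h2)
  have heval : ∀ {ψ}, ψ ∈ Θ → h (eval (fun q => e.symm (V' q)) ψ) = eval V ψ := by
    refine fun hψ => map_eval_of_satisfiesCDC (subformulaClosed_sub φ) (fun q hq => ?_)
      (fun a ha => ?_) hψ
    · change gabbayInclusion m V Θ (i _) = _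
      rw [hie, e.apply_symm_apply]
      exact hV'.val q (hV'.subset hq)
    · obtain ⟨ψ, hψ, ha⟩ := ha
      exact hD a (Finset.mem_coe.2 (Finset.mem_filter.2 ⟨Finset.mem_univ _, ψ, hψ, ha⟩)) 1 le_rfl hm
  obtain ⟨d, hd⟩ := exists_isOpremum_of_isStable hc hinj hst
  refine ⟨mStableCanonicalFormula m D p, ⟨X, _, _, D, p, fun q => e.symm (V' q),
    isSubdirectlyIrreducible_of_isOpremum hd, isAlgebraOf_logicK4_iff.2 hX, fun h' => hV ?_,
    fun ψ hψ => ?_, fun a => (hp a).trans_le (natCard_gabbayAlgebra_le m V φ), rfl⟩,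
    not_validates_mStableCanonicalFormula hc hinj hst hD p⟩
  · rw [← heval (self_mem_sub φ), h', map_top]
  · refine Finset.mem_filter.2 ⟨Finset.mem_univ _, ψ, hψ, ?_⟩
    exact heval (subformulaClosed_sub φ _ hψ (Finset.mem_insert_of_mem (self_mem_sub ψ)))

/-- Every formula is equivalent to finitely many `m`-stable canonical formulas on subdirectly
irreducible pre-transitive algebras. -/
lemma validates_iff_validates_refutationFormulas {m : ℕ} (hm : 1 ≤ m) {φ : Formula}
    {B : Type*} [ModalAlgebra B] (hB : ModalAlgebra.IsPreTransitive m B)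
    (hsi : IsSubdirectlyIrreducible B) :
    Validates B φ ↔ ∀ γ ∈ refutationFormulas m (gabbayBound m φ) φ, Validates B γ := by
  refine ⟨fun h γ hγ => validates_of_mem_refutationFormulas hm hγ hB h, fun h => ?_⟩
  by_contra hφ
  obtain ⟨γ, hγ, hn⟩ := exists_mem_refutationFormulas_not_validates hm hB hsi hφ
  exact hn (h γ hγ)

lemma validates_conj_iff {B : Type*} [ModalAlgebra B] (Ψ : Finset Formula) :
    Validates B (conj Ψ) ↔ ∀ ψ ∈ Ψ, Validates B ψ := by
  simp only [Validates, ← top_le_iff, le_eval_conj_iff]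
  exact ⟨fun h ψ hψ V => h V ψ hψ, fun h V ψ hψ => h ψ hψ V⟩

end Patterns

lemma Formula.subst_var (φ : Formula) : φ.subst var = φ := by
  induction φ <;> simp_all [Formula.subst]

/-! ## Theories and their Lindenbaum algebras -/

/-- Boolean truth assignments, where formulas `◇ ψ` are treated like variables. -/
structure IsTruthAssignment (v : Formula → Prop) : Prop where
  bot : ¬ v bot
  neg : ∀ ψ, v (neg ψ) ↔ ¬ v ψ
  or : ∀ ψ χ, v (Formula.or ψ χ) ↔ v ψ ∨ v χ

namespace IsTruthAssignment

variable {v : Formula → Prop} (hv : IsTruthAssignment v) (φ ψ : Formula)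
include hv

lemma top : v top := by simp [Formula.top, hv.neg, hv.bot]
lemma and : v (Formula.and φ ψ) ↔ v φ ∧ v ψ := by simp [Formula.and, hv.neg, hv.or]
lemma imp : v (imp φ ψ) ↔ (v φ → v ψ) := by simp [Formula.imp, hv.neg, hv.or, imp_iff_not_or]
lemma iff : v (Formula.iff φ ψ) ↔ (v φ ↔ v ψ) := by
  simp [Formula.iff, hv.and, hv.imp, iff_iff_implies_and_implies]

end IsTruthAssignment

/-- Sets of formulas that contain all theorems of `K` and are closed under modus ponens and
necessitation, but not necessarily under substitution. -/
structure IsTheory (T : Set Formula) : Prop where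
  taut : ∀ φ, IsTautology φ → φ ∈ T
  axiomK : ∀ φ ψ, imp (box (imp φ ψ)) (imp (box φ) (box ψ)) ∈ T
  dual : ∀ φ, Formula.iff (dia φ) (neg (box (neg φ))) ∈ T
  mp : ∀ φ ψ, φ ∈ T → imp φ ψ ∈ T → ψ ∈ T
  nec : ∀ φ, φ ∈ T → box φ ∈ T

lemma IsLogic.isTheory {L : Set Formula} (hL : IsLogic L) : IsTheory L where
  taut := hL.taut
  axiomK φ ψ := hL.subst (fun p => if p = 0 then φ else ψ) _ hL.axiomK
  dual φ := hL.subst (fun _ => φ) _ hL.dual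
  mp := hL.mp
  nec := hL.nec

namespace IsTheory

variable {T : Set Formula} (hT : IsTheory T)
include hT

/-- All propositional reasoning inside a theory is reduced to truth assignments here, where it can
be left to `tauto`. -/
lemma mem_of_consequence (Γ : List Formula) {φ : Formula} (hΓ : ∀ γ ∈ Γ, γ ∈ T)
    (h : ∀ v, IsTruthAssignment v → (∀ γ ∈ Γ, v γ) → v φ) : φ ∈ T := by
  induction Γ generalizing φ with
  | nil => exact hT.taut φ fun v h1 h2 h3 => h v ⟨h1, h2, h3⟩ (by simp)
  | cons γ Γ ih =>
    refine hT.mp γ φ (hΓ γ (by simp)) (ih (fun γ' h' => hΓ γ' (by simp [h'])) fun v hv h' => ?_)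
    rw [hv.imp]
    exact fun hγ => h v hv (by simpa using ⟨hγ, h'⟩)

lemma dia_mono {φ ψ : Formula} (h : imp φ ψ ∈ T) : imp (dia φ) (dia ψ) ∈ T := by
  have h1 : imp (neg ψ) (neg φ) ∈ T := hT.mem_of_consequence [imp φ ψ] (by simpa using h) <| by
    intro v hv
    simp [hv.imp, hv.neg]
    tauto
  have h2 := hT.mp _ _ (hT.nec _ h1) (hT.axiomK _ _)
  refine hT.mem_of_consequence [_, _, _] (by simpa using ⟨h2, hT.dual φ, hT.dual ψ⟩) ?_
  intro v hv
  simp [hv.imp, hv.neg, hv.iff]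
  tauto

lemma dia_bot : imp (dia bot) bot ∈ T := by
  have h1 : neg bot ∈ T := hT.taut _ fun v h1 h2 _ => (h2 _).2 h1
  refine hT.mem_of_consequence [_, _] (by simpa using ⟨hT.nec _ h1, hT.dual bot⟩) ?_
  intro v hv
  simp [hv.imp, hv.neg, hv.iff]
  tauto

lemma dia_or (φ ψ : Formula) :
    imp (dia (Formula.or φ ψ)) (Formula.or (dia φ) (dia ψ)) ∈ T := by
  have h1 : imp (neg φ) (imp (neg ψ) (neg (Formula.or φ ψ))) ∈ T :=
    hT.mem_of_consequence [] (by simp) fun v hv => by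
      simp [hv.imp, hv.neg, hv.or]
      tauto
  have h2 := hT.mp _ _ (hT.nec _ h1) (hT.axiomK _ _)
  refine hT.mem_of_consequence [_, _, _, _, _] (by simpa using ⟨h2, hT.axiomK (neg ψ)
    (neg (Formula.or φ ψ)), hT.dual φ, hT.dual ψ, hT.dual (Formula.or φ ψ)⟩) ?_
  intro v hv
  simp [hv.imp, hv.neg, hv.iff, hv.or]
  tauto

/-- Provable equivalence in a theory. -/
def setoid : Setoid Formula where
  r φ ψ := imp φ ψ ∈ T ∧ imp ψ φ ∈ T
  iseqv := by
    have htr : ∀ {φ ψ χ}, imp φ ψ ∈ T → imp ψ χ ∈ T → imp φ χ ∈ T := fun h1 h2 =>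
      hT.mem_of_consequence [_, _] (by simpa using ⟨h1, h2⟩) fun v hv => by
        simp [hv.imp]
        tauto
    refine ⟨fun φ => ?_, fun h => ⟨h.2, h.1⟩, fun h1 h2 => ⟨htr h1.1 h2.1, htr h2.2 h1.2⟩⟩
    have : imp φ φ ∈ T := hT.mem_of_consequence [] (by simp) fun v hv => by simp [hv.imp]
    exact ⟨this, this⟩

/-- The Lindenbaum algebra of a theory. -/
def Lindenbaum : Type := Quotient hT.setoid

/-- The class of a formula in the Lindenbaum algebra. -/
def cls (φ : Formula) : hT.Lindenbaum := Quotient.mk hT.setoid φ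

instance : LE hT.Lindenbaum where
  le := Quotient.lift₂ (fun φ ψ => imp φ ψ ∈ T) <| by
    rintro φ ψ φ' ψ' ⟨h1, h2⟩ ⟨h3, h4⟩
    refine propext ⟨fun h => ?_, fun h => ?_⟩
    · refine hT.mem_of_consequence [_, _, _] (by simpa using ⟨h2, h, h3⟩) fun v hv => ?_
      simp [hv.imp]
      tauto
    · refine hT.mem_of_consequence [_, _, _] (by simpa using ⟨h1, h, h4⟩) fun v hv => ?_
      simp [hv.imp]
      tauto

lemma cls_le_cls {φ ψ : Formula} : hT.cls φ ≤ hT.cls ψ ↔ imp φ ψ ∈ T := Iff.rfl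

lemma cls_surjective : Function.Surjective hT.cls := Quotient.mk_surjective

instance : Max hT.Lindenbaum where
  max := Quotient.map₂ Formula.or <| by
    rintro φ φ' ⟨h1, h2⟩ ψ ψ' ⟨h3, h4⟩
    constructor
    · refine hT.mem_of_consequence [_, _] (by simpa using ⟨h1, h3⟩) fun v hv => ?_
      simp [hv.imp, hv.or]
      tauto
    · refine hT.mem_of_consequence [_, _] (by simpa using ⟨h2, h4⟩) fun v hv => ?_
      simp [hv.imp, hv.or]
      tauto

instance : Compl hT.Lindenbaum where
  compl := Quotient.map Formula.neg <| by
    rintro φ φ' ⟨h1, h2⟩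
    constructor
    · refine hT.mem_of_consequence [_] (by simpa using h2) fun v hv => ?_
      simp [hv.imp, hv.neg]
      tauto
    · refine hT.mem_of_consequence [_] (by simpa using h1) fun v hv => ?_
      simp [hv.imp, hv.neg]
      tauto

instance : PartialOrder hT.Lindenbaum where
  le_refl a := by
    obtain ⟨φ, rfl⟩ := hT.cls_surjective a
    exact (hT.setoid.refl φ).1
  le_trans a b c := by
    obtain ⟨φ, rfl⟩ := hT.cls_surjective a
    obtain ⟨ψ, rfl⟩ := hT.cls_surjective b
    obtain ⟨χ, rfl⟩ := hT.cls_surjective c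
    simp only [cls_le_cls]
    intro h1 h2
    refine hT.mem_of_consequence [_, _] (by simpa using ⟨h1, h2⟩) fun v hv => ?_
    simp [hv.imp]
    tauto
  le_antisymm a b := by
    obtain ⟨φ, rfl⟩ := hT.cls_surjective a
    obtain ⟨ψ, rfl⟩ := hT.cls_surjective b
    exact fun h1 h2 => Quotient.sound ⟨h1, h2⟩

lemma cls_le_cls_of_forall {φ ψ : Formula} (h : ∀ v, IsTruthAssignment v → v φ → v ψ) :
    hT.cls φ ≤ hT.cls ψ :=
  hT.mem_of_consequence [] (by simp) fun v hv _ => (hv.imp _ _).2 (h v hv)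

instance : Lattice hT.Lindenbaum where
  sup := max
  inf a b := (aᶜ ⊔ bᶜ)ᶜ
  le_sup_left a b := by
    obtain ⟨φ, rfl⟩ := hT.cls_surjective a
    obtain ⟨ψ, rfl⟩ := hT.cls_surjective b
    exact hT.cls_le_cls_of_forall fun v hv h => (hv.or _ _).2 (Or.inl h)
  le_sup_right a b := by
    obtain ⟨φ, rfl⟩ := hT.cls_surjective a
    obtain ⟨ψ, rfl⟩ := hT.cls_surjective b
    exact hT.cls_le_cls_of_forall fun v hv h => (hv.or _ _).2 (Or.inr h)
  sup_le a b c := by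
    obtain ⟨φ, rfl⟩ := hT.cls_surjective a
    obtain ⟨ψ, rfl⟩ := hT.cls_surjective b
    obtain ⟨χ, rfl⟩ := hT.cls_surjective c
    intro h1 h2
    refine hT.mem_of_consequence [_, _] (by simpa using ⟨h1, h2⟩) fun v hv => ?_
    simp [hv.imp, hv.or]
    tauto
  inf_le_left a b := by
    obtain ⟨φ, rfl⟩ := hT.cls_surjective a
    obtain ⟨ψ, rfl⟩ := hT.cls_surjective b
    exact hT.cls_le_cls_of_forall fun v hv h => ((hv.and _ _).1 h).1
  inf_le_right a b := by
    obtain ⟨φ, rfl⟩ := hT.cls_surjective a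
    obtain ⟨ψ, rfl⟩ := hT.cls_surjective b
    exact hT.cls_le_cls_of_forall fun v hv h => ((hv.and _ _).1 h).2
  le_inf a b c := by
    obtain ⟨φ, rfl⟩ := hT.cls_surjective a
    obtain ⟨ψ, rfl⟩ := hT.cls_surjective b
    obtain ⟨χ, rfl⟩ := hT.cls_surjective c
    intro h1 h2
    refine hT.mem_of_consequence (φ := imp φ (Formula.and ψ χ)) [_, _]
      (by simpa using ⟨h1, h2⟩) fun v hv => ?_
    simp [hv.imp, hv.and]
    tauto

instance : ModalAlgebra hT.Lindenbaum where
  le_sup_inf a b c := by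
    obtain ⟨φ, rfl⟩ := hT.cls_surjective a
    obtain ⟨ψ, rfl⟩ := hT.cls_surjective b
    obtain ⟨χ, rfl⟩ := hT.cls_surjective c
    refine hT.cls_le_cls_of_forall (φ := Formula.and (Formula.or φ ψ) (Formula.or φ χ))
      (ψ := Formula.or φ (Formula.and ψ χ)) fun v hv h => ?_
    simp only [hv.and, hv.or] at h ⊢
    tauto
  top := hT.cls top
  bot := hT.cls bot
  inf_compl_le_bot a := by
    obtain ⟨φ, rfl⟩ := hT.cls_surjective a
    exact hT.cls_le_cls_of_forall (φ := Formula.and φ (neg φ)) fun v hv h => by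
      simp [hv.and, hv.neg] at h
  top_le_sup_compl a := by
    obtain ⟨φ, rfl⟩ := hT.cls_surjective a
    exact hT.cls_le_cls_of_forall (ψ := Formula.or φ (neg φ)) fun v hv h => by
      simp [hv.or, hv.neg, em]
  le_top a := by
    obtain ⟨φ, rfl⟩ := hT.cls_surjective a
    exact hT.cls_le_cls_of_forall fun v hv _ => hv.top
  bot_le a := by
    obtain ⟨φ, rfl⟩ := hT.cls_surjective a
    exact hT.cls_le_cls_of_forall fun v hv h => absurd h hv.bot
  dia := Quotient.map Formula.dia fun φ ψ h => ⟨hT.dia_mono h.1, hT.dia_mono h.2⟩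
  dia_bot := Quotient.sound ⟨hT.dia_bot, hT.cls_le_cls_of_forall fun v hv h => absurd h hv.bot⟩
  dia_sup a b := by
    obtain ⟨φ, rfl⟩ := hT.cls_surjective a
    obtain ⟨ψ, rfl⟩ := hT.cls_surjective b
    refine Quotient.sound ⟨hT.dia_or φ ψ, ?_⟩
    have h1 := hT.dia_mono (φ := φ) (ψ := Formula.or φ ψ)
      (le_sup_left (a := hT.cls φ) (b := hT.cls ψ))
    have h2 := hT.dia_mono (φ := ψ) (ψ := Formula.or φ ψ)
      (le_sup_right (a := hT.cls φ) (b := hT.cls ψ))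
    refine hT.mem_of_consequence [_, _] (by simpa using ⟨h1, h2⟩) fun v hv => ?_
    simp [hv.imp, hv.or]
    tauto

lemma cls_eq_top_iff {φ : Formula} : hT.cls φ = ⊤ ↔ φ ∈ T := by
  rw [← top_le_iff]
  change imp top φ ∈ T ↔ _
  constructor <;> intro h <;> refine hT.mem_of_consequence [_] (by simpa using h) fun v hv => ?_
  · simp [hv.imp, hv.top]
  · simp [hv.imp, hv.top]

lemma eval_cls (σ : ℕ → Formula) (φ : Formula) :
    eval (fun p => hT.cls (σ p)) φ = hT.cls (φ.subst σ) := by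
  induction φ with
  | var p => rfl
  | bot => rfl
  | neg φ ih => rw [eval_neg, ih]; rfl
  | or φ ψ ih1 ih2 => rw [eval_or, ih1, ih2]; rfl
  | dia φ ih => rw [eval_dia, ih]; rfl

lemma validates_lindenbaum_iff {φ : Formula} :
    Validates hT.Lindenbaum φ ↔ ∀ σ : ℕ → Formula, φ.subst σ ∈ T := by
  constructor
  · intro h σ
    rw [← hT.cls_eq_top_iff, ← hT.eval_cls]
    exact h _
  · intro h V
    choose σ hσ using fun p => hT.cls_surjective (V p)
    rw [← funext hσ, hT.eval_cls, hT.cls_eq_top_iff]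
    exact h σ

lemma mem_of_validates_lindenbaum {φ : Formula} (h : Validates hT.Lindenbaum φ) : φ ∈ T := by
  simpa only [Formula.subst_var] using hT.validates_lindenbaum_iff.1 h var

/-- Valuations in the Lindenbaum algebra are substitutions, so closure of L under substitution is
enough; T itself need not be closed. -/
lemma isAlgebraOf_lindenbaum {L : Set Formula} (hL : IsLogic L) (h : L ⊆ T) :
    IsAlgebraOf L hT.Lindenbaum := fun _ hφ =>
  hT.validates_lindenbaum_iff.2 fun σ => h (hL.subst σ _ hφ)

lemma le_cls_of_mem {x : hT.Lindenbaum} {φ : Formula} (h : φ ∈ T) : x ≤ hT.cls φ :=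
  (hT.cls_eq_top_iff.2 h).symm ▸ le_top

lemma cls_imp (φ ψ : Formula) : hT.cls (imp φ ψ) = hT.cls φ ⇨ hT.cls ψ := by
  rw [himp_eq, sup_comm]
  rfl

/-- Openness of x is exactly what necessitation requires. -/
lemma isTheory_le_cls {x : hT.Lindenbaum} (hx : x ≤ ModalAlgebra.box x) :
    IsTheory {χ | x ≤ hT.cls χ} where
  taut φ h := hT.le_cls_of_mem (hT.taut φ h)
  axiomK φ ψ := hT.le_cls_of_mem (hT.axiomK φ ψ)
  dual φ := hT.le_cls_of_mem (hT.dual φ)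
  mp φ ψ h1 h2 := by
    change x ≤ hT.cls (imp φ ψ) at h2
    rw [cls_imp, le_himp_iff] at h2
    exact (le_inf le_rfl h1).trans h2
  nec φ h := hx.trans (show ModalAlgebra.box x ≤ ModalAlgebra.box (hT.cls φ) from
    ModalAlgebra.box_mono h)

/-- The Lindenbaum algebra of a pre-transitive theory that is maximal among those omitting some
formula is subdirectly irreducible. -/
lemma isSubdirectlyIrreducible_of_maximal {m : ℕ} (hm : 1 ≤ m) {φ : Formula} (hK : logicK4 m ⊆ T)
    (hφ : φ ∉ T) (hmax : ∀ T', IsTheory T' → T ⊆ T' → φ ∉ T' → T' ⊆ T) :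
    IsSubdirectlyIrreducible hT.Lindenbaum := by
  have hpre := isAlgebraOf_logicK4_iff.1
    (hT.isAlgebraOf_lindenbaum (isLogic_addFormulas _ _ : IsLogic (logicK4 m)) hK)
  refine isSubdirectlyIrreducible_of_isOpremum (m := m) (c := hT.cls φ)
    ⟨fun h => hφ (hT.cls_eq_top_iff.1 h), fun a ha => ?_⟩
  obtain ⟨ψ, rfl⟩ := hT.cls_surjective a
  by_contra hle
  -- If □^{≤m}ψ were not below φ, the theory it generates over T would still omit φ, so maximality
  -- would put ψ into T.
  have hsub := hmax _ (hT.isTheory_le_cls (hpre.boxLe_le_box hm (hT.cls ψ)))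
    (fun χ hχ => hT.le_cls_of_mem hχ) hle
  exact ha (hT.cls_eq_top_iff.2 (hsub (ModalAlgebra.boxLe_le_self m (hT.cls ψ))))

lemma exists_maximal {φ : Formula} (hφ : φ ∉ T) : ∃ M, IsTheory M ∧ T ⊆ M ∧ φ ∉ M ∧
    ∀ T', IsTheory T' → M ⊆ T' → φ ∉ T' → T' ⊆ M := by
  have hzorn := zorn_subset_nonempty {M | IsTheory M ∧ φ ∉ M} fun C hC hchain hne => by
    obtain ⟨M₀, hM₀⟩ := hne
    refine ⟨⋃₀ C, ⟨⟨?_, ?_, ?_, ?_, ?_⟩, ?_⟩, fun M hM => Set.subset_sUnion_of_mem hM⟩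
    · exact fun ψ h => ⟨M₀, hM₀, (hC hM₀).1.taut ψ h⟩
    · exact fun ψ χ => ⟨M₀, hM₀, (hC hM₀).1.axiomK ψ χ⟩
    · exact fun ψ => ⟨M₀, hM₀, (hC hM₀).1.dual ψ⟩
    · rintro ψ χ ⟨M₁, h1, hψ⟩ ⟨M₂, h2, hχ⟩
      rcases hchain.total h1 h2 with h | h
      · exact ⟨M₂, h2, (hC h2).1.mp ψ χ (h hψ) hχ⟩
      · exact ⟨M₁, h1, (hC h1).1.mp ψ χ hψ (h hχ)⟩
    · rintro ψ ⟨M, h, hψ⟩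
      exact ⟨M, h, (hC h).1.nec ψ hψ⟩
    · rintro ⟨M, h, hM⟩
      exact (hC h).2 hM
  obtain ⟨M, hTM, hM⟩ := hzorn T ⟨hT, hφ⟩
  exact ⟨M, hM.prop.1, hTM, hM.prop.2, fun T' h1 h2 h3 => hM.le_of_ge ⟨h1, h3⟩ h2⟩

end IsTheory

/-- A formula that is valid in all subdirectly irreducible algebras of a logic above
`K4^{m+1}_1` belongs to the logic. -/
lemma IsLogic.mem_of_forall_isSubdirectlyIrreducible {m : ℕ} (hm : 1 ≤ m) {L : Set Formula}
    (hL : IsLogic L) (hK : logicK4 m ⊆ L) {φ : Formula}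
    (h : ∀ (B : Type) [ModalAlgebra B], IsSubdirectlyIrreducible B → IsAlgebraOf L B →
      Validates B φ) : φ ∈ L := by
  by_contra hφ
  obtain ⟨M, hM, hLM, hφM, hmax⟩ := hL.isTheory.exists_maximal hφ
  exact hφM (hM.mem_of_validates_lindenbaum (h hM.Lindenbaum
    (hM.isSubdirectlyIrreducible_of_maximal hm (hK.trans hLM) hφM hmax)
    (hM.isAlgebraOf_lindenbaum hL hLM)))

/-! ## Rule systems -/

lemma isRuleSystem_addRules (S₀ R : Set Rule) : IsRuleSystem (addRules S₀ R) where
  refl φ _ hS _ := hS.refl φ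
  mp φ ψ _ hS _ := hS.mp φ ψ
  nec φ _ hS _ := hS.nec φ
  ofK φ h _ hS _ := hS.ofK φ h
  weakening Γ Δ Γ' Δ' h S hS hs := hS.weakening Γ Δ Γ' Δ' (h S hS hs)
  cut Γ Δ φ h1 h2 S hS hs := hS.cut Γ Δ φ (h1 S hS hs) (h2 S hS hs)
  subst σ Γ Δ h S hS hs := hS.subst σ Γ Δ (h S hS hs)

lemma subset_addRules (S₀ R : Set Rule) : S₀ ∪ R ⊆ addRules S₀ R := fun _ h _ _ hs => hs h

lemma addRules_subset {S₀ R S : Set Rule} (hS : IsRuleSystem S) (h₀ : S₀ ⊆ S) (h : R ⊆ S) :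
    addRules S₀ R ⊆ S :=
  fun _ hρ => hρ S hS (Set.union_subset h₀ h)

lemma addRules_mono {S₀ R R' : Set Rule} (h : R ⊆ R') : addRules S₀ R ⊆ addRules S₀ R' :=
  addRules_subset (isRuleSystem_addRules _ _) (Set.subset_union_left.trans (subset_addRules _ _))
    (h.trans (Set.subset_union_right.trans (subset_addRules _ _)))

lemma ruleSystemOf_subset_iff {L : Set Formula} {S : Set Rule} (hS : IsRuleSystem S) :
    ruleSystemOf L ⊆ S ↔ ∀ φ ∈ L, Rule.ofFormula φ ∈ S := by
  constructor
  · exact fun h φ hφ => h (subset_addRules _ _ (Or.inr ⟨φ, hφ, rfl⟩))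
  · intro h
    refine addRules_subset hS (Set.empty_subset _) ?_
    rintro _ ⟨φ, hφ, rfl⟩
    exact h φ hφ

/-- The theorems of a rule system form a logic. -/
lemma IsRuleSystem.isLogic {S : Set Rule} (hS : IsRuleSystem S) :
    IsLogic {φ | Rule.ofFormula φ ∈ S} where
  taut φ h := hS.ofK φ ((isLogic_addFormulas _ _ : IsLogic logicK).taut φ h)
  axiomK := hS.ofK _ (isLogic_addFormulas _ _ : IsLogic logicK).axiomK
  dual := hS.ofK _ (isLogic_addFormulas _ _ : IsLogic logicK).dual
  mp φ ψ h1 h2 := by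
    refine hS.cut ∅ {ψ} φ ?_ (hS.cut _ {ψ} (imp φ ψ) ?_ ?_)
    · exact hS.weakening ∅ {φ} ∅ {ψ} h1
    · simpa using hS.weakening ∅ {imp φ ψ} {φ} {ψ} h2
    · have := hS.mp φ ψ
      rwa [Finset.pair_comm] at this
  nec φ h := by
    refine hS.cut ∅ {box φ} φ (hS.weakening ∅ {φ} ∅ {box φ} h) ?_
    exact hS.nec φ
  subst σ φ h := by simpa [Rule.ofFormula] using hS.subst σ ∅ {φ} h

/-- The rules admissible in `L`. -/
def admissibleRules (L : Set Formula) : Set Rule :=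
  {ρ | ∀ σ : ℕ → Formula, (∀ γ ∈ ρ.prem, γ.subst σ ∈ L) → ∃ δ ∈ ρ.concl, δ.subst σ ∈ L}

lemma Formula.subst_subst (σ τ : ℕ → Formula) (φ : Formula) :
    (φ.subst σ).subst τ = φ.subst fun p => (σ p).subst τ := by
  induction φ <;> simp_all [Formula.subst]

lemma isRuleSystem_admissibleRules {L : Set Formula} (hL : IsLogic L) :
    IsRuleSystem (admissibleRules L) where
  refl φ σ h := ⟨φ, by simp, h φ (by simp)⟩
  mp φ ψ σ h := ⟨ψ, by simp, hL.mp _ _ (h φ (by simp)) (h (imp φ ψ) (by simp))⟩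
  nec φ σ h := ⟨box φ, by simp, hL.nec _ (h φ (by simp))⟩
  ofK φ hφ σ _ := ⟨φ, by simp [Rule.ofFormula], hL.subst σ φ (hL.logicK_subset hφ)⟩
  weakening Γ Δ Γ' Δ' h σ hΓ := by
    obtain ⟨δ, hδ, h'⟩ := h σ fun γ hγ => hΓ γ (Finset.mem_union_left _ hγ)
    exact ⟨δ, Finset.mem_union_left _ hδ, h'⟩
  cut Γ Δ φ h1 h2 σ hΓ := by
    obtain ⟨δ, hδ, h'⟩ := h1 σ hΓ
    rcases Finset.mem_insert.1 hδ with rfl | hδ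
    · refine h2 σ fun γ hγ => ?_
      rcases Finset.mem_insert.1 hγ with rfl | hγ
      exacts [h', hΓ γ hγ]
    · exact ⟨δ, hδ, h'⟩
  subst σ Γ Δ h τ hΓ := by
    obtain ⟨δ, hδ, h'⟩ := h (fun p => (σ p).subst τ) fun γ hγ => by
      rw [← Formula.subst_subst]
      exact hΓ _ (Finset.mem_image_of_mem _ hγ)
    exact ⟨_, Finset.mem_image_of_mem _ hδ, by rwa [Formula.subst_subst]⟩

/-- `S_L` is conservative over `L`. -/
lemma ofFormula_mem_ruleSystemOf_iff {L : Set Formula} (hL : IsLogic L) {φ : Formula} :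
    Rule.ofFormula φ ∈ ruleSystemOf L ↔ φ ∈ L := by
  constructor
  · intro h
    -- The admissible rules form a rule system containing / ψ for all ψ in L; admissibility of / φ
    -- under the identity substitution puts φ in L.
    have hsub : ruleSystemOf L ⊆ admissibleRules L :=
      (ruleSystemOf_subset_iff (isRuleSystem_admissibleRules hL)).2 fun ψ hψ σ _ =>
        ⟨ψ, by simp [Rule.ofFormula], hL.subst σ ψ hψ⟩
    obtain ⟨δ, hδ, h'⟩ := hsub h var fun γ hγ => absurd hγ (Finset.notMem_empty γ)
    rw [Rule.ofFormula, Finset.mem_singleton] at hδ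
    rwa [hδ, Formula.subst_var] at h'
  · exact fun h => (ruleSystemOf_subset_iff (isRuleSystem_addRules _ _)).1 subset_rfl φ h

/-- An axiomatization of a logic by formulas is an axiomatization of its rule system. -/
lemma axiomatizedBy_ofFormula_image_iff {L₀ L Ψ : Set Formula} (hL : IsLogic L) :
    AxiomatizedBy L₀ L (Rule.ofFormula '' Ψ) ↔ L = addFormulas L₀ Ψ := by
  have key : addRules (ruleSystemOf L₀) (Rule.ofFormula '' Ψ) =
      ruleSystemOf (addFormulas L₀ Ψ) := by
    refine Set.Subset.antisymm (addRules_subset (isRuleSystem_addRules _ _) ?_ ?_) ?_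
    · refine (ruleSystemOf_subset_iff (isRuleSystem_addRules _ _)).2 fun φ hφ => ?_
      exact (ofFormula_mem_ruleSystemOf_iff (isLogic_addFormulas _ _)).2
        (subset_addFormulas _ _ (Or.inl hφ))
    · rintro _ ⟨φ, hφ, rfl⟩
      exact (ofFormula_mem_ruleSystemOf_iff (isLogic_addFormulas _ _)).2
        (subset_addFormulas _ _ (Or.inr hφ))
    · have hS := isRuleSystem_addRules (ruleSystemOf L₀) (Rule.ofFormula '' Ψ)
      have hsub := subset_addRules (ruleSystemOf L₀) (Rule.ofFormula '' Ψ)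
      refine (ruleSystemOf_subset_iff hS).2 (addFormulas_subset hS.isLogic ?_ ?_)
      · exact (ruleSystemOf_subset_iff hS).1 (Set.subset_union_left.trans hsub)
      · exact fun φ hφ => hsub (Or.inr ⟨φ, hφ, rfl⟩)
  rw [AxiomatizedBy, key]
  refine ⟨fun h => ?_, fun h => by rw [← h]⟩
  ext φ
  rw [← ofFormula_mem_ruleSystemOf_iff hL, h,
    ofFormula_mem_ruleSystemOf_iff (isLogic_addFormulas _ _)]

/-- Derivations use finitely many rules. -/
lemma exists_finite_of_mem_addRules {S₀ R : Set Rule} {ρ : Rule} (h : ρ ∈ addRules S₀ R) :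
    ∃ F ⊆ R, F.Finite ∧ ρ ∈ addRules S₀ F := by
  have hS : ∀ F, IsRuleSystem (addRules S₀ F) := isRuleSystem_addRules S₀
  have hempty : ∀ {ρ}, ρ ∈ addRules S₀ ∅ → ∃ F ⊆ R, F.Finite ∧ ρ ∈ addRules S₀ F := fun h =>
    ⟨∅, Set.empty_subset _, Set.finite_empty, h⟩
  -- The rules derivable from finite parts of R already form a rule system; only cut has to merge
  -- two finite parts.
  refine h {ρ | ∃ F ⊆ R, F.Finite ∧ ρ ∈ addRules S₀ F} ?_ ?_
  · refine ⟨fun φ => hempty ((hS _).refl φ), fun φ ψ => hempty ((hS _).mp φ ψ),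
      fun φ => hempty ((hS _).nec φ), fun φ hφ => hempty ((hS _).ofK φ hφ), ?_, ?_, ?_⟩
    · rintro Γ Δ Γ' Δ' ⟨F, h1, h2, h3⟩
      exact ⟨F, h1, h2, (hS _).weakening _ _ _ _ h3⟩
    · rintro Γ Δ φ ⟨F, h1, h2, h3⟩ ⟨F', h1', h2', h3'⟩
      exact ⟨F ∪ F', Set.union_subset h1 h1', h2.union h2', (hS _).cut _ _ φ
        (addRules_mono Set.subset_union_left h3) (addRules_mono Set.subset_union_right h3')⟩
    · rintro σ Γ Δ ⟨F, h1, h2, h3⟩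
      exact ⟨F, h1, h2, (hS _).subst _ _ _ h3⟩
  · rintro ρ (h | h)
    · exact hempty (subset_addRules _ _ (Or.inl h))
    · exact ⟨{ρ}, Set.singleton_subset_iff.2 h, Set.finite_singleton ρ,
        subset_addRules _ _ (Or.inr rfl)⟩

/-- If a finite set of rules axiomatizes `L`, then every axiomatization of `L` contains a finite
one. -/
lemma AxiomatizedBy.exists_finite {L₀ L : Set Formula} {R R' : Set Rule}
    (h : AxiomatizedBy L₀ L R) (hR : R.Finite) (h' : AxiomatizedBy L₀ L R') :
    ∃ F ⊆ R', F.Finite ∧ AxiomatizedBy L₀ L F := by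
  have hmem : ∀ ρ : R, ∃ F ⊆ R', F.Finite ∧ (ρ : Rule) ∈ addRules (ruleSystemOf L₀) F :=
    fun ρ => exists_finite_of_mem_addRules
      ((h.symm.trans h').subset (subset_addRules _ _ (Or.inr ρ.2)))
  choose F h1 h2 h3 using hmem
  have := hR.to_subtype
  refine ⟨⋃ ρ, F ρ, Set.iUnion_subset h1, Set.finite_iUnion h2, ?_⟩
  refine Set.Subset.antisymm ?_ ?_
  · rw [h]
    refine addRules_subset (isRuleSystem_addRules _ _)
      (Set.subset_union_left.trans (subset_addRules _ _)) fun ρ hρ => ?_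
    exact addRules_mono (Set.subset_iUnion F ⟨ρ, hρ⟩) (h3 ⟨ρ, hρ⟩)
  · rw [h']
    exact addRules_mono (Set.iUnion_subset h1)

/-! ## Axiomatization by `m`-stable canonical formulas -/

/-- Every logic above `K4^{m+1}_1` is axiomatized by the `m`-stable canonical formulas that it
contains. -/
lemma IsLogic.eq_addFormulas_isMStableCanonical {m : ℕ} (hm : 1 ≤ m) {L : Set Formula}
    (hL : IsLogic L) (hK : logicK4 m ⊆ L) :
    L = addFormulas (logicK4 m) {ψ | IsMStableCanonical m ψ ∧ ψ ∈ L} := by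
  refine Set.Subset.antisymm (fun φ hφ => ?_) (addFormulas_subset hL hK fun ψ h => h.2)
  have hsub := subset_addFormulas (logicK4 m) {ψ | IsMStableCanonical m ψ ∧ ψ ∈ L}
  have hLK := hL.isTheory.isAlgebraOf_lindenbaum (isLogic_addFormulas _ _ : IsLogic (logicK4 m)) hK
  refine (isLogic_addFormulas _ _).mem_of_forall_isSubdirectlyIrreducible hm
    (Set.subset_union_left.trans hsub) fun B _ hsi hB => ?_
  refine (validates_iff_validates_refutationFormulas hm (isAlgebraOf_logicK4_iff.1 fun ψ hψ =>
    hB ψ (hsub (Or.inl hψ))) hsi).2 fun γ hγ => hB γ (hsub (Or.inr ⟨?_, ?_⟩))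
  · exact .of_mem_refutationFormulas hγ
  -- The passage from φ to γ holds on all pre-transitive algebras, so it applies to the Lindenbaum
  -- algebra of L, which need not be s.i.
  · exact hL.isTheory.mem_of_validates_lindenbaum (validates_of_mem_refutationFormulas hm hγ
      (isAlgebraOf_logicK4_iff.1 hLK) (hL.isTheory.isAlgebraOf_lindenbaum hL subset_rfl φ hφ))

end PreTransitive

theorem mainTheorem8 (m : ℕ) (hm : 1 ≤ m) :
    -- Gabbay's filtration is a definable filtration, yields a `K4^{m+1}_1`-algebra, and its
    -- inclusion satisfies the `m`-closed domain condition
    (∀ (A : Type*) [ModalAlgebra A],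
      IsAlgebraOf (logicK4 m) A →
      ∀ (V : ℕ → A) (Θ : Finset Formula), SubformulaClosed Θ →
        (∃ V' : ℕ → GabbayAlgebra m V Θ,
          IsDefinableFiltration V Θ (gabbaySet m Θ)
            (gabbayInclusion m V Θ) V') ∧
        IsAlgebraOf (logicK4 m) (GabbayAlgebra m V Θ) ∧
        SatisfiesMCDC m (gabbayInclusion m V Θ)
          (closedDomain V Θ (gabbayInclusion m V Θ))) ∧
    -- every formula is equivalent to finitely many `m`-stable canonical formulas on
    -- subdirectly irreducible `K4^{m+1}_1`-algebras
    (∀ φ : Formula, ∃ Ψ : Finset Formula,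
      (∀ ψ ∈ Ψ, IsMStableCanonical m ψ) ∧
      ∀ (B : Type*) [ModalAlgebra B], IsSubdirectlyIrreducible B →
        IsAlgebraOf (logicK4 m) B →
        (Validates B φ ↔
          Validates B (Formula.conj Ψ))) ∧
    -- axiomatization
    (∀ L : Set Formula, IsLogic L → logicK4 m ⊆ L →
      (∃ Ψ : Set Formula, (∀ ψ ∈ Ψ, IsMStableCanonical m ψ) ∧
        AxiomatizedBy (logicK4 m) L
          (Rule.ofFormula '' Ψ) ∧
        L = addFormulas (logicK4 m) Ψ) ∧
      ((∃ R : Set Rule, R.Finite ∧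
          AxiomatizedBy (logicK4 m) L R) →
        ∃ Ψ : Set Formula, Ψ.Finite ∧
          (∀ ψ ∈ Ψ, IsMStableCanonical m ψ) ∧
          AxiomatizedBy (logicK4 m) L
            (Rule.ofFormula '' Ψ) ∧
          L = addFormulas (logicK4 m) Ψ)) := by
  refine ⟨fun A _ hA V Θ hΘ => ?_, fun φ => ?_, fun L hL hK => ?_⟩
  · have hA' := isAlgebraOf_logicK4_iff.1 hA
    exact ⟨exists_isDefinableFiltration_gabbay m V Θ hm hA' hΘ,
      isAlgebraOf_logicK4_iff.2 (isPreTransitive_gabbayAlgebra m V Θ),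
      satisfiesMCDC_gabbayInclusion m V Θ hA'⟩
  · have hfin := finite_refutationFormulas m (gabbayBound m φ) φ
    refine ⟨hfin.toFinset, fun ψ hψ => .of_mem_refutationFormulas (hfin.mem_toFinset.1 hψ),
      fun B _ hsi hB => ?_⟩
    rw [validates_conj_iff, validates_iff_validates_refutationFormulas hm
      (isAlgebraOf_logicK4_iff.1 hB) hsi]
    simp only [hfin.mem_toFinset]
  · have heq := hL.eq_addFormulas_isMStableCanonical hm hK
    have hax := (axiomatizedBy_ofFormula_image_iff hL).2 heq
    refine ⟨⟨_, fun ψ hψ => hψ.1, hax, heq⟩, ?_⟩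
    rintro ⟨R, hR, hLR⟩
    obtain ⟨Ψ, hΨ, hΨfin, hLF⟩ :=
      Set.exists_subset_image_finite_and.1 (hLR.exists_finite hR hax)
    exact ⟨Ψ, hΨfin, fun ψ hψ => (hΨ hψ).1, hLF, (axiomatizedBy_ofFormula_image_iff hL).1 hLF⟩
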